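/- Consider a finite Markov decision process with state space $S$, action space $A$, transition kernel $P_{\rm env}(s'\mid s,a)$ and reward $r(s,a)$, and a fixed policy $\pi$. Put $r_{\max}=\max_{s,a}|r(s,a)|$, $P(s'\mid s)=\sum_a P_{\rm env}(s'\mid s,a)\pi(a\mid s)$, $r_s=\sum_a\pi(a\mid s)r(s,a)$ and $R=(r_s)_{s\in S}$. Assume that the Markov chain with transition matrix $P$ is irreducible and aperiodic, let $\mu$ be its stationary distribution and $D=\mathrm{diag}(\mu)$. Let $\Phi\in\mathbb R^{S\times d}$ have linearly independent columns and rows $\phi(s)^\top$ with $\|\phi(s)\|\le 1$ (Euclidean norms throughout), and set \[ \eta=\min_{\|x\|=1}\ \|\Phi x\|_{\rm Dir}^2+(\mu^\top\Phi x)^2,\qquad \|f\|_{\rm Dir}^2=\tfrac12\sum_{s,s'}\mu(s)P(s'\mid s)(f(s)-f(s'))^2 . \] For $\varepsilon>0$ let $\tau_{\rm mix}(\varepsilon)$ be the least integer $\tau\ge0$ with $\max_s\sum_{s'}|P^{\tau}(s'\mid s)-\mu(s')|\le\varepsilon$. Let $(s_t)_{t\ge0}$ be a Markov chain with transition matrix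 $P$ (with any initial distribution). The projected single-chain algorithm with constant stepsizes $\alpha>0$, $\beta>0$ and projection radii $R_w$, $R_\theta$ is \[ w_{t+1}={\rm Proj}_{R_w}\{w_t+\beta(\phi(s_t)-w_t)\}, \] \[ \theta_{t+1}={\rm Proj}_{R_\theta}\big\{\theta_t+\alpha\big[(r_{s_t}+\phi(s_{t+1})^\top\theta_t-\phi(s_t)^\top\theta_t)\phi(s_t)-(r_{s_t}+\phi(s_t)^\top\theta_t)w_t\big]\big\}, \] where ${\rm Proj}_{\varrho}$ is the Euclidean projection onto the closed ball of radius $\varrho$ about $0$, and $w_0,\theta_0$ are deterministic with $\|w_0\|\le1$, $\|\theta_0\|\le R_\theta$. Let $w^*=\Phi^\top\mu$ and let $\theta^*$ be the solution of $\Phi^\top D(R+P\Phi\theta^*-\Phi\theta^*)-\mu^\top(R+\Phi\theta^*)\,w^*=0$. Assume $R_w\ge1$, $R_\theta>0$ and $\|\theta^*\|\le R_\theta$. Let $\rho_0=\beta/\alpha\le1$, $\tau_{\rm mix}=\tau_{\rm mix}(\min\{\alpha,\beta\})$, let $\lambda>0$ satisfy $\lambda^2<2\eta/(r_{\max}+2R_\theta)$,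 and put $\zeta=\eta-\lambda^2(r_{\max}+2R_\theta)/2$. Assume $\alpha<1/(2\zeta)$ and define \[ \kappa=1-2\alpha\zeta,\qquad G_1=e^{-2\rho_0\alpha},\qquad \rho=\max\{\kappa,G_1\}, \] \[ G_{\rm const}=\frac{(16\tau_{\rm mix}+6)(r_{\max}+2R_\theta)}{\lambda^2}+(88\tau_{\rm mix}+4)(r_{\max}+3R_\theta)^2 . \] Then $\zeta>0$, the numbers $\kappa,G_1,\rho$ lie in $(0,1)$, and for all $t\ge\tau_{\rm mix}$ \[ \mathbb E\|\theta_t-\theta^*\|^2\le\frac{4\alpha(r_{\max}+2R_\theta)(t-\tau_{\rm mix})\rho^{\,t-\tau_{\rm mix}}}{\lambda^2}+4R_\theta^2\kappa^{\,t-\tau_{\rm mix}}+\frac{\alpha\,G_{\rm const}}{2\zeta}. \] -/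

import Mathlib

open MeasureTheory Matrix

noncomputable section

namespace AvgRewardTD

/-- A finite Markov decision process with state space `S` and action space `A`:
`trans s a s'` is the probability of moving from `s` to `s'` under action `a`. -/
structure FiniteMDP (S A : Type*) [Fintype S] where
  trans : S → A → S → ℝ
  trans_nonneg : ∀ s a s', 0 ≤ trans s a s'
  trans_sum : ∀ s a, ∑ s', trans s a s' = 1
  reward : S → A → ℝ

/-- A stationary randomized policy: `prob s a` is the probability of action `a` in state `s`. -/
structure Policy (S A : Type*) [Fintype A] where
  prob : S → A → ℝ
  prob_nonneg : ∀ s a, 0 ≤ prob s a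
  prob_sum : ∀ s, ∑ a, prob s a = 1

/-- The largest absolute reward `max_{s,a} |r(s,a)|`. -/
def FiniteMDP.rMax {S A : Type*} [Fintype S] (M : FiniteMDP S A) : ℝ :=
  ⨆ p : S × A, |M.reward p.1 p.2|

/-- The transition matrix induced by the policy. -/
def FiniteMDP.transMatrix {S A : Type*} [Fintype S] [Fintype A]
    (M : FiniteMDP S A) (pol : Policy S A) : Matrix S S ℝ :=
  Matrix.of fun s s' => ∑ a, M.trans s a s' * pol.prob s a

/-- The expected one-step rewards under the policy. -/
def FiniteMDP.rewardVec {S A : Type*} [Fintype S] [Fintype A]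
    (M : FiniteMDP S A) (pol : Policy S A) : S → ℝ :=
  fun s => ∑ a, pol.prob s a * M.reward s a

section Chain

variable {S : Type*} [Fintype S] [DecidableEq S]

/-- Every state has period one: the only common divisor of its possible return times is `1`. -/
def IsAperiodic (P : Matrix S S ℝ) : Prop :=
  ∀ s, ∀ k : ℕ, (∀ n : ℕ, 0 < n → 0 < (P ^ n) s s → k ∣ n) → k = 1

/-- `μ` is a stationary probability distribution of `P`. -/
structure IsStationary (P : Matrix S S ℝ) (μ : S → ℝ) : Prop where
  nonneg : ∀ s, 0 ≤ μ s
  sum_one : ∑ s, μ s = 1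
  vecMul_eq : μ ᵥ* P = μ

/-- The mixing time at accuracy `ε`: the first `τ` at which the `τ`-step distributions from all
starting states are within `ε` of `μ` in `ℓ¹` norm. -/
def mixingTime (P : Matrix S S ℝ) (μ : S → ℝ) (ε : ℝ) : ℕ :=
  sInf {τ : ℕ | ∀ s, ∑ s', |(P ^ τ) s s' - μ s'| ≤ ε}

/-- The squared Dirichlet seminorm. -/
def dirichletSq (P : Matrix S S ℝ) (μ : S → ℝ) (f : S → ℝ) : ℝ :=
  (1 / 2) * ∑ s, ∑ s', μ s * P s s' * (f s - f s') ^ 2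

/-- The process `X` is a time-homogeneous Markov chain with transition matrix `P` (and an
arbitrary initial distribution). -/
structure IsMarkovChain {Ω : Type*} [MeasurableSpace Ω] (ℙ : Measure Ω)
    (P : Matrix S S ℝ) (X : ℕ → Ω → S) : Prop where
  measurableSet_eq : ∀ t x, MeasurableSet {ω | X t ω = x}
  prob_path : ∀ (n : ℕ) (x : ℕ → S),
    ℙ.real {ω | ∀ i ≤ n, X i ω = x i}
      = ℙ.real {ω | X 0 ω = x 0} * ∏ i ∈ Finset.range n, P (x i) (x (i + 1))

end Chain

section Algorithm

variable {S : Type*} {d : ℕ}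

/-- The feature vector of a state: the corresponding row of the feature matrix. -/
def feature (Φ : Matrix S (Fin d) ℝ) (s : S) : EuclideanSpace ℝ (Fin d) :=
  WithLp.toLp 2 (Φ s)

/-- Euclidean projection onto the closed ball of radius `R` about the origin. -/
def projBall (R : ℝ) (x : EuclideanSpace ℝ (Fin d)) : EuclideanSpace ℝ (Fin d) :=
  if ‖x‖ ≤ R then x else (R / ‖x‖) • x

/-- The update direction of the auxiliary iterate. -/
def fUpdate (Φ : Matrix S (Fin d) ℝ) (s : S) (w : EuclideanSpace ℝ (Fin d)) :
    EuclideanSpace ℝ (Fin d) :=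
  feature Φ s - w

/-- The update direction of the parameter iterate. -/
def gUpdate (Φ : Matrix S (Fin d) ℝ) (R : S → ℝ) (s s' : S)
    (w θ : EuclideanSpace ℝ (Fin d)) : EuclideanSpace ℝ (Fin d) :=
  (R s + inner ℝ (feature Φ s') θ - inner ℝ (feature Φ s) θ) • feature Φ s
    - (R s + inner ℝ (feature Φ s) θ) • w

/-- The iterates `(w_t, θ_t)` of the projected single-chain algorithm along a trajectory `x` of
states, the successor of `x t` being `x (t + 1)`. -/
def singleChain (Φ : Matrix S (Fin d) ℝ) (R : S → ℝ) (α β Rw Rθ : ℝ)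
    (w₀ θ₀ : EuclideanSpace ℝ (Fin d)) (x : ℕ → S) :
    ℕ → EuclideanSpace ℝ (Fin d) × EuclideanSpace ℝ (Fin d)
  | 0 => (w₀, θ₀)
  | t + 1 =>
    let p := singleChain Φ R α β Rw Rθ w₀ θ₀ x t
    (projBall Rw (p.1 + β • fUpdate Φ (x t) p.1),
      projBall Rθ (p.2 + α • gUpdate Φ R (x t) (x (t + 1)) p.1 p.2))

variable [Fintype S] [DecidableEq S]

/-- `w* = Φᵀ μ`. -/
def wStar (Φ : Matrix S (Fin d) ℝ) (μ : S → ℝ) : EuclideanSpace ℝ (Fin d) :=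
  WithLp.toLp 2 (Φᵀ *ᵥ μ)

/-- The stationary mean of `gUpdate`, where `D` is the diagonal matrix of `μ`:
`Φᵀ D (R + P Φ θ - Φ θ) - (μᵀ (R + Φ θ)) w`. -/
def gBar (P : Matrix S S ℝ) (μ : S → ℝ) (Φ : Matrix S (Fin d) ℝ) (R : S → ℝ)
    (w θ : EuclideanSpace ℝ (Fin d)) : EuclideanSpace ℝ (Fin d) :=
  WithLp.toLp 2 (Φᵀ *ᵥ (Matrix.diagonal μ *ᵥ (R + P *ᵥ (Φ *ᵥ θ.ofLp) - Φ *ᵥ θ.ofLp)))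
    - (μ ⬝ᵥ (R + Φ *ᵥ θ.ofLp)) • w

/-- The condition number `η = min_{‖x‖ = 1} ‖Φ x‖²_Dir + (μᵀ Φ x)²`. -/
def eta (P : Matrix S S ℝ) (μ : S → ℝ) (Φ : Matrix S (Fin d) ℝ) : ℝ :=
  sInf ((fun x : EuclideanSpace ℝ (Fin d) =>
    dirichletSq P μ (Φ *ᵥ x.ofLp) + (μ ⬝ᵥ (Φ *ᵥ x.ofLp)) ^ 2) '' Metric.sphere 0 1)

end Algorithm

end AvgRewardTD

end

/-!
With `e = θ - θ*`, the mean direction satisfies `⟨e, ḡ(w*, θ)⟩ = -(‖Φ e‖²_Dir + (μᵀ Φ e)²)`, so it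
contracts `‖e‖²` at rate `2 η`. Replacing `w_t` by `w*` costs a cross term, which Young's inequality
with weight `λ²` splits into a loss of `λ² (r_max + 2 R_θ) / 2` in the rate and a multiple of
`‖w_t - w*‖²`; the latter decays geometrically, because the projection of `w_t` is never active and
`w_t` is an exponential moving average of the features. Both for `w_t` and for `θ_t` the Markovian
noise is controlled by conditioning on the past `τ` steps back: the iterates have moved by `O(τ α)`
since then, and `P ^ τ` is `α`-close to `μ`. If `τ = 0` and `α < 1`, there is a single state and
hence no noise; if `1 ≤ α`, the constant term of the bound already exceeds `(2 R_θ)²`, an a priori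
bound on `‖e‖²`.
-/

namespace AvgRewardTD

section Mixing

variable {S : Type*} [Fintype S] {P : Matrix S S ℝ} {μ : S → ℝ}

theorem IsStationary.le_one (hμ : IsStationary P μ) (s : S) : μ s ≤ 1 :=
  hμ.sum_one ▸ Finset.single_le_sum (fun i _ => hμ.nonneg i) (Finset.mem_univ s)

-- Doeblin: subtracting the minorant `δ μ` does not change `v ᵥ* Q`, because `v` has total mass `0`.
theorem sum_abs_vecMul_le {Q : Matrix S S ℝ} {δ : ℝ}
    (hQ : ∀ i j, δ * μ j ≤ Q i j) (hrow : ∀ i, ∑ j, Q i j = 1) (hμ : ∑ j, μ j = 1)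
    {v : S → ℝ} (hv : ∑ i, v i = 0) :
    ∑ j, |(v ᵥ* Q) j| ≤ (1 - δ) * ∑ i, |v i| := by
  have vecMul_apply_eq (j : S) : (v ᵥ* Q) j = ∑ i, v i * (Q i j - δ * μ j) := by
    simp [vecMul, dotProduct, mul_sub, ← Finset.sum_mul, hv]
  calc ∑ j, |(v ᵥ* Q) j| ≤ ∑ j, ∑ i, |v i| * (Q i j - δ * μ j) := by
        gcongr with j
        rw [vecMul_apply_eq]
        refine (Finset.abs_sum_le_sum_abs _ _).trans_eq (Finset.sum_congr rfl fun i _ => ?_)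
        rw [abs_mul, abs_of_nonneg (sub_nonneg.2 (hQ i j))]
    _ = (1 - δ) * ∑ i, |v i| := by
        rw [Finset.sum_comm]
        simp only [← Finset.mul_sum, Finset.sum_sub_distrib, hrow, hμ, ← Finset.sum_mul]
        ring

variable [DecidableEq S]

theorem pow_add_apply_pos (hP : ∀ i j, 0 ≤ P i j) {m n : ℕ} {i j k : S}
    (hm : 0 < (P ^ m) i j) (hn : 0 < (P ^ n) j k) : 0 < (P ^ (m + n)) i k := by
  rw [pow_add, Matrix.mul_apply]
  exact Finset.sum_pos' (fun l _ => mul_nonneg (pow_apply_nonneg hP m i l)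
    (pow_apply_nonneg hP n l k)) ⟨j, Finset.mem_univ j, mul_pos hm hn⟩

theorem IsAperiodic.eventually_pow_apply_self_pos (haper : IsAperiodic P) (hP : ∀ i j, 0 ≤ P i j)
    (s : S) : ∀ᶠ m in Filter.atTop, 0 < (P ^ m) s s := by
  set T : Set ℕ := {n | 0 < n ∧ 0 < (P ^ n) s s}
  have hgcd : Nat.setGcd T = 1 :=
    haper s _ fun n hpos hn => Nat.setGcd_dvd_of_mem (s := T) ⟨hpos, hn⟩
  obtain ⟨N, hN⟩ := Nat.exists_mem_closure_of_ge T
  have mem_closure : ∀ᶠ m in Filter.atTop, m ∈ AddSubmonoid.closure T :=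
    Filter.eventually_atTop.2 ⟨N, fun m hm => hN m hm (hgcd ▸ one_dvd m)⟩
  filter_upwards [mem_closure] with m hm
  induction hm using AddSubmonoid.closure_induction with
  | mem n hn => exact hn.2
  | zero => simp
  | add m n _ _ ihm ihn => exact pow_add_apply_pos hP ihm ihn

theorem IsAperiodic.eventually_pow_apply_pos (haper : IsAperiodic P) (hirr : P.IsIrreducible)
    (s s' : S) : ∀ᶠ m in Filter.atTop, 0 < (P ^ m) s s' := by
  obtain ⟨k, -, hk⟩ := (isIrreducible_iff_exists_pow_pos hirr.nonneg).1 hirr s s'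
  rw [← Filter.map_add_atTop_eq_nat k, Filter.eventually_map]
  filter_upwards [haper.eventually_pow_apply_self_pos hirr.nonneg s] with m hm
  exact pow_add_apply_pos hirr.nonneg hm hk

theorem IsAperiodic.isPrimitive (haper : IsAperiodic P) (hirr : P.IsIrreducible) :
    P.IsPrimitive where
  nonneg := hirr.nonneg
  exists_pos_pow := ((Filter.eventually_gt_atTop 0).and <| Filter.eventually_all.2 fun s =>
    Filter.eventually_all.2 fun s' => haper.eventually_pow_apply_pos hirr s s').exists

theorem sum_abs_vecMul_pow_le {Q : Matrix S S ℝ} {δ : ℝ} (hQ : Q ∈ rowStochastic ℝ S)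
    (hδ : δ ≤ 1) (hmin : ∀ i j, δ * μ j ≤ Q i j) (hμ : ∑ j, μ j = 1) {v : S → ℝ}
    (hv : ∑ i, v i = 0) (k : ℕ) :
    ∑ j, |(v ᵥ* Q ^ k) j| ≤ (1 - δ) ^ k * ∑ i, |v i| := by
  induction k with
  | zero => simp
  | succ k ih =>
    have sum_eq_zero : ∑ j, (v ᵥ* Q ^ k) j = 0 := by
      rw [← dotProduct_one, ← dotProduct_mulVec,
        one_vecMul_of_mem_rowStochastic (pow_mem hQ k), dotProduct_one, hv]
    rw [pow_succ, ← vecMul_vecMul, pow_succ', mul_assoc]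
    exact (sum_abs_vecMul_le hmin (sum_row_of_mem_rowStochastic hQ) hμ sum_eq_zero).trans
      (mul_le_mul_of_nonneg_left ih (sub_nonneg.2 hδ))

theorem IsStationary.vecMul_pow (hμ : IsStationary P μ) (n : ℕ) : μ ᵥ* P ^ n = μ := by
  induction n with
  | zero => simp
  | succ n ih => rw [pow_succ, ← vecMul_vecMul, ih, hμ.vecMul_eq]

theorem IsStationary.exists_sum_abs_pow_sub_le (hμ : IsStationary P μ) (hprim : P.IsPrimitive)
    (hP : P ∈ rowStochastic ℝ S) {ε : ℝ} (hε : 0 < ε) :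
    ∃ τ : ℕ, ∀ s, ∑ s', |(P ^ τ) s s' - μ s'| ≤ ε := by
  obtain ⟨N, -, hN⟩ := hprim.exists_pos_pow
  rcases isEmpty_or_nonempty S with hS | hS
  · exact ⟨0, hS.elim⟩
  obtain ⟨⟨i₀, j₀⟩, hmin⟩ := Finite.exists_min fun p : S × S => (P ^ N) p.1 p.2
  set δ := (P ^ N) i₀ j₀
  have hδ : 0 < δ := hN i₀ j₀
  have hPN : P ^ N ∈ rowStochastic ℝ S := pow_mem hP N
  have hmin' (i j : S) : δ * μ j ≤ (P ^ N) i j :=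
    (mul_le_of_le_one_right hδ.le (hμ.le_one j)).trans (hmin (i, j))
  let v (s : S) : S → ℝ := Pi.single s 1 - μ
  have pow_sub_eq (k : ℕ) (s s' : S) :
      (P ^ (N * k)) s s' - μ s' = (v s ᵥ* (P ^ N) ^ k) s' := by
    simp [v, sub_vecMul, ← pow_mul, hμ.vecMul_pow]
  have hv (s : S) : ∑ i, v s i = 0 := by simp [v, hμ.sum_one]
  let C := ∑ s, ∑ i, |v s i|
  obtain ⟨k, hk⟩ : ∃ k : ℕ, (1 - δ) ^ k * C < ε :=
    (((tendsto_pow_atTop_nhds_zero_of_lt_one (sub_nonneg.2 (le_one_of_mem_rowStochastic hPN))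
      (sub_lt_self 1 hδ)).mul_const C).eventually_lt_const (by simpa using hε)).exists
  refine ⟨N * k, fun s => ?_⟩
  simp only [pow_sub_eq]
  calc ∑ s', |(v s ᵥ* (P ^ N) ^ k) s'| ≤ (1 - δ) ^ k * ∑ i, |v s i| :=
        sum_abs_vecMul_pow_le hPN (le_one_of_mem_rowStochastic hPN) hmin' hμ.sum_one (hv s) k
    _ ≤ (1 - δ) ^ k * C := by
        gcongr
        · exact pow_nonneg (sub_nonneg.2 (le_one_of_mem_rowStochastic hPN)) k
        · exact Finset.single_le_sum (f := fun s => ∑ i, |v s i|)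
            (fun s _ => Finset.sum_nonneg fun i _ => abs_nonneg _) (Finset.mem_univ s)
    _ ≤ ε := hk.le

theorem IsStationary.sum_abs_pow_mixingTime_sub_le (hμ : IsStationary P μ)
    (hprim : P.IsPrimitive) (hP : P ∈ rowStochastic ℝ S) {ε : ℝ} (hε : 0 < ε) (s : S) :
    ∑ s', |(P ^ mixingTime P μ ε) s s' - μ s'| ≤ ε :=
  Nat.sInf_mem (hμ.exists_sum_abs_pow_sub_le hprim hP hε) s

theorem subsingleton_of_sum_abs_one_sub_lt
    (h : ∀ s, ∑ s', |(1 : Matrix S S ℝ) s s' - μ s'| < 1) : Subsingleton S := by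
  refine ⟨fun a b => by_contra fun hab => ?_⟩
  have mass_lt {a b : S} (hab : a ≠ b) : (1 - μ a) + μ b < 1 :=
    calc (1 - μ a) + μ b ≤ |(1 : Matrix S S ℝ) a a - μ a| + |(1 : Matrix S S ℝ) a b - μ b| := by
          rw [one_apply_eq, one_apply_ne hab, zero_sub, abs_neg]
          exact add_le_add (le_abs_self _) (le_abs_self _)
      _ = ∑ s' ∈ {a, b}, |(1 : Matrix S S ℝ) a s' - μ s'| := by rw [Finset.sum_pair hab]
      _ ≤ ∑ s', |(1 : Matrix S S ℝ) a s' - μ s'| :=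
          Finset.sum_le_sum_of_subset_of_nonneg (Finset.subset_univ _) fun _ _ _ => abs_nonneg _
      _ < 1 := h a
  linarith [mass_lt hab, mass_lt (Ne.symm hab)]

end Mixing

section MDP

variable {S A : Type*} [Fintype S] [Fintype A]

theorem FiniteMDP.transMatrix_mem_rowStochastic [DecidableEq S]
    (M : FiniteMDP S A) (pol : Policy S A) : M.transMatrix pol ∈ rowStochastic ℝ S := by
  refine mem_rowStochastic_iff_sum.2 ⟨fun i j => Finset.sum_nonneg fun a _ =>
    mul_nonneg (M.trans_nonneg i a j) (pol.prob_nonneg i a), fun i => ?_⟩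
  simp only [FiniteMDP.transMatrix, of_apply]
  rw [Finset.sum_comm]
  simp only [← Finset.sum_mul, M.trans_sum, one_mul, pol.prob_sum]

theorem FiniteMDP.abs_rewardVec_le (M : FiniteMDP S A) (pol : Policy S A) (s : S) :
    |M.rewardVec pol s| ≤ M.rMax :=
  calc |M.rewardVec pol s| ≤ ∑ a, |pol.prob s a * M.reward s a| := Finset.abs_sum_le_sum_abs _ _
    _ ≤ ∑ a, pol.prob s a * M.rMax := by
        gcongr with a
        rw [abs_mul, abs_of_nonneg (pol.prob_nonneg s a)]
        exact mul_le_mul_of_nonneg_left (le_ciSup (f := fun p : S × A => |M.reward p.1 p.2|)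
          (Set.finite_range _).bddAbove (s, a)) (pol.prob_nonneg s a)
    _ = M.rMax := by rw [← Finset.sum_mul, pol.prob_sum, one_mul]

end MDP

section FiniteRange

variable {Ω T : Type*} [MeasurableSpace Ω] {ℙ : Measure Ω} [IsFiniteMeasure ℙ] {Y : Ω → T}

theorem integrable_comp_of_finite [Finite T] {E : Type*} [NormedAddCommGroup E]
    (hY : ∀ y, MeasurableSet (Y ⁻¹' {y})) (g : T → E) : Integrable (fun ω => g (Y ω)) ℙ := by
  let _ : MeasurableSpace T := ⊤
  have hYm : Measurable Y := measurable_to_countable' hY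
  exact (Integrable.of_finite (f := g)).comp_measurable hYm

theorem integral_comp_eq_sum [Fintype T] (hY : ∀ y, MeasurableSet (Y ⁻¹' {y})) (g : T → ℝ) :
    ∫ ω, g (Y ω) ∂ℙ = ∑ y, ℙ.real (Y ⁻¹' {y}) * g y := by
  let _ : MeasurableSpace T := ⊤
  have hYm : Measurable Y := measurable_to_countable' hY
  rw [← integral_map hYm.aemeasurable (.of_discrete (f := g)),
    integral_fintype .of_finite]
  simp only [map_measureReal_apply hYm (measurableSet_singleton _), smul_eq_mul]

end FiniteRange

section MarkovChain

variable {S Ω : Type*} [MeasurableSpace Ω] {ℙ : Measure Ω}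
  {P : Matrix S S ℝ} {μ : S → ℝ} {X : ℕ → Ω → S}

theorem IsMarkovChain.measurableSet_path (hX : IsMarkovChain ℙ P X) (n : ℕ)
    (y : Set.Iic n → S) : MeasurableSet ((fun ω (i : Set.Iic n) => X i ω) ⁻¹' {y}) := by
  have preimage_eq : (fun ω (i : Set.Iic n) => X i ω) ⁻¹' {y}
      = ⋂ i : Set.Iic n, {ω | X i ω = y i} := by
    ext ω
    simp [funext_iff]
  rw [preimage_eq]
  exact .iInter fun i => hX.measurableSet_eq i (y i)

theorem IsMarkovChain.integrable_comp [Finite S] [IsFiniteMeasure ℙ] (hX : IsMarkovChain ℙ P X)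
    {E : Type*} [NormedAddCommGroup E] {n : ℕ} {F : (ℕ → S) → E}
    (hF : DependsOn F (Set.Iic n)) : Integrable (fun ω => F fun i => X i ω) ℙ := by
  obtain ⟨g, rfl⟩ := dependsOn_iff_exists_comp.1 hF
  exact integrable_comp_of_finite (hX.measurableSet_path n) g

theorem IsMarkovChain.prob_path_succ (hX : IsMarkovChain ℙ P X) (n : ℕ) (x : ℕ → S) :
    ℙ.real {ω | ∀ i ≤ n + 1, X i ω = x i}
      = ℙ.real {ω | ∀ i ≤ n, X i ω = x i} * P (x n) (x (n + 1)) := by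
  rw [hX.prob_path, hX.prob_path, Finset.prod_range_succ, mul_assoc]

theorem IsMarkovChain.prob_succ_path (hX : IsMarkovChain ℙ P X) (n : ℕ) (s : S)
    (y : Set.Iic n → S) :
    ℙ.real ((fun ω => (X (n + 1) ω, fun i : Set.Iic n => X i ω)) ⁻¹' {(s, y)})
      = ℙ.real ((fun ω (i : Set.Iic n) => X i ω) ⁻¹' {y}) * P (y ⟨n, Set.self_mem_Iic⟩) s := by
  obtain ⟨x, rfl, rfl⟩ : ∃ x : ℕ → S, s = x (n + 1) ∧ y = fun i : Set.Iic n => x i :=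
    ⟨fun i => if h : i ≤ n then y ⟨i, h⟩ else s, by simp,
      funext fun i => by simp [Set.mem_Iic.1 i.2]⟩
  convert hX.prob_path_succ n x using 3
  · ext ω
    simp [funext_iff, Nat.le_add_one_iff, or_imp, forall_and, and_comm]
  · ext ω
    simp [funext_iff]

theorem sum_mul_le_of_sum_abs_sub_le [Fintype S] {p h : S → ℝ} {ε C : ℝ} (hp : ∑ s, |p s - μ s| ≤ ε)
    (hh : ∀ s, |h s| ≤ C) (hC : 0 ≤ C) (hμ : ∑ s, μ s * h s = 0) : ∑ s, p s * h s ≤ ε * C :=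
  calc ∑ s, p s * h s = ∑ s, (p s - μ s) * h s := by
        simp only [sub_mul, Finset.sum_sub_distrib, hμ, sub_zero]
    _ ≤ ∑ s, |p s - μ s| * C := by
        refine Finset.sum_le_sum fun s _ => (le_abs_self _).trans ?_
        rw [abs_mul]
        exact mul_le_mul_of_nonneg_left (hh s) (abs_nonneg _)
    _ ≤ ε * C := by
        rw [← Finset.sum_mul]
        gcongr

variable [Fintype S] [IsFiniteMeasure ℙ]

theorem IsMarkovChain.integral_comp_succ (hX : IsMarkovChain ℙ P X) {n : ℕ}
    {H : S → (ℕ → S) → ℝ} (hH : ∀ s, DependsOn (H s) (Set.Iic n)) :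
    ∫ ω, H (X (n + 1) ω) (fun i => X i ω) ∂ℙ
      = ∫ ω, ∑ s, P (X n ω) s * H s (fun i => X i ω) ∂ℙ := by
  choose g hg using fun s => dependsOn_iff_exists_comp.1 (hH s)
  obtain rfl : H = fun s => g s ∘ (Set.Iic n).domRestrict := funext hg
  have measurableSet_pair (p : S × (Set.Iic n → S)) :
      MeasurableSet ((fun ω => (X (n + 1) ω, fun i : Set.Iic n => X i ω)) ⁻¹' {p}) := by
    rw [← Set.singleton_prod_singleton, Set.mk_preimage_prod]
    exact (hX.measurableSet_eq (n + 1) p.1).inter (hX.measurableSet_path n p.2)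
  calc ∫ ω, g (X (n + 1) ω) (fun i => X i ω) ∂ℙ
      = ∑ p : S × (Set.Iic n → S),
          ℙ.real ((fun ω (i : Set.Iic n) => X i ω) ⁻¹' {p.2}) * P (p.2 ⟨n, Set.self_mem_Iic⟩) p.1
            * g p.1 p.2 := by
        rw [integral_comp_eq_sum measurableSet_pair fun p => g p.1 p.2]
        simp only [← hX.prob_succ_path]
    _ = ∫ ω, ∑ s, P (X n ω) s * g s (fun i => X i ω) ∂ℙ := by
        rw [integral_comp_eq_sum (hX.measurableSet_path n)
          fun y => ∑ s, P (y ⟨n, Set.self_mem_Iic⟩) s * g s y, Fintype.sum_prod_type_right]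
        simp only [Finset.mul_sum, mul_assoc]

variable [DecidableEq S]

theorem IsMarkovChain.integral_comp_add (hX : IsMarkovChain ℙ P X) {m : ℕ} (k : ℕ)
    {H : S → (ℕ → S) → ℝ} (hH : ∀ s, DependsOn (H s) (Set.Iic m)) :
    ∫ ω, H (X (m + k) ω) (fun i => X i ω) ∂ℙ
      = ∫ ω, ∑ s, (P ^ k) (X m ω) s * H s (fun i => X i ω) ∂ℙ := by
  induction k generalizing H with
  | zero => simp [one_apply]
  | succ k ih =>
    have hPH (s : S) : DependsOn (fun x => ∑ s', P s s' * H s' x) (Set.Iic m) :=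
      fun x y hxy => Finset.sum_congr rfl fun s' _ => by rw [hH s' hxy]
    rw [← add_assoc, hX.integral_comp_succ fun s => (hH s).mono (Set.Iic_subset_Iic.2 le_self_add),
      ih hPH]
    simp only [pow_succ, mul_apply, Finset.sum_mul, Finset.mul_sum, mul_assoc]
    exact integral_congr_ae (.of_forall fun ω => Finset.sum_comm)

theorem IsMarkovChain.integral_lag_le [IsProbabilityMeasure ℙ] (hX : IsMarkovChain ℙ P X)
    {V : Type*} {Z : (ℕ → S) → ℕ → V} (hZ : ∀ t, DependsOn (Z · t) (Set.Iic t))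
    {f : S → V → ℝ} (hf : ∀ v, ∑ s, μ s * f s v = 0) {m k : ℕ} {ε C D : ℝ}
    (hmix : ∀ s, ∑ s', |(P ^ k) s s' - μ s'| ≤ ε) (hC : ∀ s x, |f s (Z x m)| ≤ C)
    (hD : ∀ s x, f s (Z x (m + k)) ≤ f s (Z x m) + D) :
    ∫ ω, f (X (m + k) ω) (Z (fun i => X i ω) (m + k)) ∂ℙ ≤ ε * C + D := by
  have hfZ (s : S) : DependsOn (fun x => f s (Z x m)) (Set.Iic m) :=
    fun x y hxy => congrArg (f s) (hZ m hxy)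
  have integrable_now : Integrable
      (fun ω => f (X (m + k) ω) (Z (fun i => X i ω) (m + k))) ℙ :=
    hX.integrable_comp (n := m + k) (F := fun x => f (x (m + k)) (Z x (m + k)))
      fun x y hxy => congrArg₂ f (hxy _ Set.self_mem_Iic) (hZ _ hxy)
  have integrable_lagged : Integrable (fun ω => f (X (m + k) ω) (Z (fun i => X i ω) m)) ℙ :=
    hX.integrable_comp (n := m + k) (F := fun x => f (x (m + k)) (Z x m))
      fun x y hxy => congrArg₂ f (hxy _ Set.self_mem_Iic)
        ((hZ m).mono (Set.Iic_subset_Iic.2 le_self_add) hxy)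
  have integrable_mean : Integrable
      (fun ω => ∑ s, (P ^ k) (X m ω) s * f s (Z (fun i => X i ω) m)) ℙ :=
    hX.integrable_comp (n := m) (F := fun x => ∑ s, (P ^ k) (x m) s * f s (Z x m))
      fun x y hxy => Finset.sum_congr rfl fun s _ => by
        rw [hxy m Set.self_mem_Iic]; exact congrArg _ (hfZ s hxy)
  calc ∫ ω, f (X (m + k) ω) (Z (fun i => X i ω) (m + k)) ∂ℙ
      ≤ ∫ ω, (f (X (m + k) ω) (Z (fun i => X i ω) m) + D) ∂ℙ :=
        integral_mono integrable_now (integrable_lagged.add (integrable_const D))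
          fun ω => hD _ _
    _ = ∫ ω, ∑ s, (P ^ k) (X m ω) s * f s (Z (fun i => X i ω) m) ∂ℙ + D := by
        rw [integral_add integrable_lagged (integrable_const D),
          hX.integral_comp_add k hfZ]
        simp
    _ ≤ ∫ _, ε * C ∂ℙ + D := by
        gcongr ?_ + _
        refine integral_mono integrable_mean (integrable_const _) fun ω => ?_
        exact sum_mul_le_of_sum_abs_sub_le (hmix _) (fun s => hC s _)
          ((abs_nonneg _).trans (hC (X m ω) fun i => X i ω)) (hf _)
    _ = ε * C + D := by simp

end MarkovChain

theorem le_of_linear_recurrence {κ ρ A B b c : ℝ} {u : ℕ → ℝ} (hκ : 0 ≤ κ) (hκρ : κ ≤ ρ)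
    (hb : 0 ≤ b) (hB : κ * B + c ≤ B) (h_zero : u 0 ≤ A + B)
    (h_succ : ∀ n, u (n + 1) ≤ κ * u n + b * ρ ^ (n + 1) + c) (n : ℕ) :
    u n ≤ n * b * ρ ^ n + A * κ ^ n + B := by
  induction n with
  | zero => simpa using h_zero
  | succ n ih =>
    have hρ : 0 ≤ ρ := hκ.trans hκρ
    calc u (n + 1) ≤ κ * (n * b * ρ ^ n + A * κ ^ n + B) + b * ρ ^ (n + 1) + c :=
          (h_succ n).trans (by gcongr)
      _ = κ * (n * b * ρ ^ n) + b * ρ ^ (n + 1) + A * κ ^ (n + 1) + (κ * B + c) := by ring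
      _ ≤ ρ * (n * b * ρ ^ n) + b * ρ ^ (n + 1) + A * κ ^ (n + 1) + B := by gcongr
      _ = (n + 1 : ℕ) * b * ρ ^ (n + 1) + A * κ ^ (n + 1) + B := by push_cast; ring

section NormedSpace

variable {E : Type*} [NormedAddCommGroup E]

theorem norm_add_sub_le_mul {u : ℕ → E} {c : ℝ} (h : ∀ n, ‖u (n + 1) - u n‖ ≤ c) (m k : ℕ) :
    ‖u (m + k) - u m‖ ≤ c * k := by
  rw [← dist_eq_norm', mul_comm, ← nsmul_eq_mul]
  refine (dist_le_Ico_sum_of_dist_le (Nat.le_add_right m k) (d := fun _ => c)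
    fun _ _ => (dist_eq_norm' _ _).trans_le (h _)).trans_eq ?_
  simp

theorem norm_sub_le_two_mul {x y : E} {C : ℝ} (hx : ‖x‖ ≤ C) (hy : ‖y‖ ≤ C) :
    ‖x - y‖ ≤ 2 * C :=
  (norm_sub_le x y).trans <| (add_le_add hx hy).trans_eq (two_mul C).symm

variable [NormedSpace ℝ E]

theorem norm_sum_smul_le_of_forall_le {ι : Type*} [Fintype ι] {p : ι → ℝ} {v : ι → E} {C : ℝ}
    (hp : ∀ i, 0 ≤ p i) (hp_sum : ∑ i, p i = 1) (hv : ∀ i, ‖v i‖ ≤ C) :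
    ‖∑ i, p i • v i‖ ≤ C :=
  mem_closedBall_zero_iff.1 <| (convex_closedBall 0 C).sum_mem (fun i _ => hp i) hp_sum
    fun i _ => mem_closedBall_zero_iff.2 (hv i)

theorem norm_add_smul_sub_le {x y : E} {C t : ℝ} (hx : ‖x‖ ≤ C) (hy : ‖y‖ ≤ C) (ht : 0 ≤ t)
    (ht' : t ≤ 1) : ‖x + t • (y - x)‖ ≤ C :=
  mem_closedBall_zero_iff.1 <| (convex_closedBall 0 C).add_smul_sub_mem
    (mem_closedBall_zero_iff.2 hx) (mem_closedBall_zero_iff.2 hy) ⟨ht, ht'⟩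

end NormedSpace

section Projection

variable {d : ℕ} {ϱ : ℝ} {x y : EuclideanSpace ℝ (Fin d)}

theorem projBall_of_norm_le (hx : ‖x‖ ≤ ϱ) : projBall ϱ x = x := if_pos hx

theorem norm_projBall_le (hϱ : 0 ≤ ϱ) (x : EuclideanSpace ℝ (Fin d)) : ‖projBall ϱ x‖ ≤ ϱ := by
  unfold projBall
  split_ifs with hx
  · exact hx
  · have hx' : 0 < ‖x‖ := hϱ.trans_lt (not_le.1 hx)
    rw [norm_smul, Real.norm_of_nonneg (by positivity), div_mul_cancel₀ _ hx'.ne']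

theorem inner_sub_projBall_nonpos (x : EuclideanSpace ℝ (Fin d)) (hy : ‖y‖ ≤ ϱ) :
    inner ℝ (x - projBall ϱ x) (y - projBall ϱ x) ≤ 0 := by
  unfold projBall
  split_ifs with hx
  · simp
  · have hϱ : 0 ≤ ϱ := (norm_nonneg y).trans hy
    have hx' : 0 < ‖x‖ := hϱ.trans_lt (not_le.1 hx)
    have hxy : inner ℝ x y ≤ ϱ * ‖x‖ := by
      rw [mul_comm]
      exact (real_inner_le_norm x y).trans (by gcongr)
    have inner_eq : inner ℝ (x - (ϱ / ‖x‖) • x) (y - (ϱ / ‖x‖) • x)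
        = (1 - ϱ / ‖x‖) * (inner ℝ x y - ϱ * ‖x‖) := by
      simp only [inner_sub_left, inner_sub_right, inner_smul_left, inner_smul_right,
        conj_trivial, real_inner_self_eq_norm_sq]
      field_simp
    rw [inner_eq]
    exact mul_nonpos_of_nonneg_of_nonpos
      (sub_nonneg.2 ((div_le_one hx').2 (not_le.1 hx).le)) (sub_nonpos.2 hxy)

theorem norm_projBall_sub_le (x : EuclideanSpace ℝ (Fin d)) (hy : ‖y‖ ≤ ϱ) :
    ‖projBall ϱ x - y‖ ≤ ‖x - y‖ := by
  rw [← sq_le_sq₀ (norm_nonneg _) (norm_nonneg _), norm_sub_rev,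
    ← sub_sub_sub_cancel_right x y (projBall ϱ x), norm_sub_sq_real (x - projBall ϱ x)]
  linarith [inner_sub_projBall_nonpos x hy, sq_nonneg ‖x - projBall ϱ x‖]

end Projection

section MovingAverage

/-- The exponential moving average `w_{t+1} = w_t + β (φ(x_t) - w_t)` of a feature along a path.
It is the auxiliary iterate of the algorithm, whose projection is never active. -/
def movingAverage {S V : Type*} [AddCommGroup V] [Module ℝ V] (β : ℝ) (φ : S → V) (w₀ : V)
    (x : ℕ → S) : ℕ → V
  | 0 => w₀
  | t + 1 => movingAverage β φ w₀ x t + β • (φ (x t) - movingAverage β φ w₀ x t)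

variable {S V : Type*} [NormedAddCommGroup V] {β : ℝ} {φ : S → V} {w₀ : V}

section NormedSpace

variable [NormedSpace ℝ V]

theorem norm_movingAverage_le (hβ : 0 ≤ β) (hβ' : β ≤ 1) (hφ : ∀ s, ‖φ s‖ ≤ 1) (hw₀ : ‖w₀‖ ≤ 1)
    (x : ℕ → S) (t : ℕ) : ‖movingAverage β φ w₀ x t‖ ≤ 1 := by
  induction t with
  | zero => exact hw₀
  | succ t ih => exact norm_add_smul_sub_le ih (hφ _) hβ hβ'

theorem dependsOn_movingAverage (t : ℕ) :
    DependsOn (movingAverage β φ w₀ · t) (Set.Iic t) := fun x y hxy => by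
  induction t with
  | zero => rfl
  | succ t ih =>
    simp only [movingAverage, hxy t (Nat.le_succ t),
      ih fun i hi => hxy i (Set.Iic_subset_Iic.2 (Nat.le_succ t) hi)]

theorem norm_movingAverage_add_sub_le (hβ : 0 ≤ β) (hβ' : β ≤ 1) (hφ : ∀ s, ‖φ s‖ ≤ 1)
    (hw₀ : ‖w₀‖ ≤ 1) (x : ℕ → S) (t k : ℕ) :
    ‖movingAverage β φ w₀ x (t + k) - movingAverage β φ w₀ x t‖ ≤ 2 * β * k := by
  refine norm_add_sub_le_mul (fun n => ?_) t k
  have step_eq : movingAverage β φ w₀ x (n + 1) - movingAverage β φ w₀ x n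
      = β • (φ (x n) - movingAverage β φ w₀ x n) := add_sub_cancel_left _ _
  rw [step_eq, norm_smul, Real.norm_of_nonneg hβ, mul_comm]
  gcongr
  linarith [norm_sub_le (φ (x n)) (movingAverage β φ w₀ x n), hφ (x n),
    norm_movingAverage_le hβ hβ' hφ hw₀ x n]

theorem movingAverage_sub_of_const {c : V} (hφ : ∀ s, φ s = c) (x : ℕ → S) (t : ℕ) :
    movingAverage β φ w₀ x t - c = (1 - β) ^ t • (w₀ - c) := by
  induction t with
  | zero => simp [movingAverage]
  | succ t ih =>
    rw [movingAverage, hφ, pow_succ', mul_smul, ← ih]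
    module

end NormedSpace

variable [InnerProductSpace ℝ V]

theorem norm_movingAverage_succ_sub_sq (c : V) (x : ℕ → S) (t : ℕ) :
    ‖movingAverage β φ w₀ x (t + 1) - c‖ ^ 2
      = (1 - β) ^ 2 * ‖movingAverage β φ w₀ x t - c‖ ^ 2
        + 2 * β * (1 - β) * inner ℝ (φ (x t) - c) (movingAverage β φ w₀ x t - c)
        + β ^ 2 * ‖φ (x t) - c‖ ^ 2 := by
  have step_eq : movingAverage β φ w₀ x (t + 1) - c
      = (1 - β) • (movingAverage β φ w₀ x t - c) + β • (φ (x t) - c) := by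
    rw [movingAverage]
    module
  rw [step_eq, norm_add_sq_real, norm_smul, norm_smul, real_inner_smul_left,
    real_inner_smul_right, real_inner_comm, mul_pow, mul_pow, Real.norm_eq_abs, Real.norm_eq_abs,
    sq_abs, sq_abs]
  ring

theorem sum_mul_inner_sub_weightedSum [Fintype S] {μ : S → ℝ} (hμ : ∑ s, μ s = 1) (v : V) :
    ∑ s, μ s * inner ℝ (φ s - ∑ s, μ s • φ s) v = 0 := by
  simp only [← real_inner_smul_left, ← sum_inner, smul_sub, Finset.sum_sub_distrib,
    ← Finset.sum_smul, hμ, one_smul, sub_self, inner_zero_left]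

variable {Ω : Type*} [MeasurableSpace Ω] {ℙ : Measure Ω} [IsProbabilityMeasure ℙ]
  [Fintype S] [DecidableEq S] {P : Matrix S S ℝ} {μ : S → ℝ} {X : ℕ → Ω → S} {τ : ℕ}

theorem IsMarkovChain.integral_inner_movingAverage_le (hX : IsMarkovChain ℙ P X)
    (hμ : IsStationary P μ) (hβ : 0 ≤ β) (hβ' : β ≤ 1) (hφ : ∀ s, ‖φ s‖ ≤ 1) (hw₀ : ‖w₀‖ ≤ 1)
    (hmix : ∀ s, ∑ s', |(P ^ τ) s s' - μ s'| ≤ β) (k : ℕ) :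
    ∫ ω, inner ℝ (φ (X (k + τ) ω) - ∑ s, μ s • φ s)
        (movingAverage β φ w₀ (fun i => X i ω) (k + τ) - ∑ s, μ s • φ s) ∂ℙ
      ≤ 4 * β * (τ + 1) := by
  set c := ∑ s, μ s • φ s
  have hc : ‖c‖ ≤ 1 := norm_sum_smul_le_of_forall_le hμ.nonneg hμ.sum_one hφ
  have norm_sub_le_two {v : V} (hv : ‖v‖ ≤ 1) : ‖v - c‖ ≤ 2 :=
    (norm_sub_le v c).trans (by linarith)
  have norm_le := norm_movingAverage_le hβ hβ' hφ hw₀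
  refine (hX.integral_lag_le (f := fun s w => inner ℝ (φ s - c) (w - c)) (C := 4)
    (D := 4 * β * τ) dependsOn_movingAverage
    (fun w => sum_mul_inner_sub_weightedSum hμ.sum_one (w - c)) hmix
    (fun s x => ?_) fun s x => ?_).trans_eq (by ring)
  · calc |inner ℝ (φ s - c) (movingAverage β φ w₀ x k - c)|
        ≤ ‖φ s - c‖ * ‖movingAverage β φ w₀ x k - c‖ := abs_real_inner_le_norm _ _
      _ ≤ 2 * 2 := by gcongr <;> exact norm_sub_le_two (by first | exact hφ s | exact norm_le x k)
      _ = 4 := by norm_num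
  · rw [← sub_le_iff_le_add', ← inner_sub_right, sub_sub_sub_cancel_right]
    calc inner ℝ (φ s - c) (movingAverage β φ w₀ x (k + τ) - movingAverage β φ w₀ x k)
        ≤ ‖φ s - c‖ * ‖movingAverage β φ w₀ x (k + τ) - movingAverage β φ w₀ x k‖ :=
          real_inner_le_norm _ _
      _ ≤ 2 * (2 * β * τ) := by
          gcongr
          · exact norm_sub_le_two (hφ s)
          · exact norm_movingAverage_add_sub_le hβ hβ' hφ hw₀ x k τ
      _ = 4 * β * τ := by ring

theorem IsMarkovChain.integral_norm_movingAverage_succ_sub_sq_le (hX : IsMarkovChain ℙ P X)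
    (hμ : IsStationary P μ) (hβ : 0 ≤ β) (hβ' : β ≤ 1) (hφ : ∀ s, ‖φ s‖ ≤ 1) (hw₀ : ‖w₀‖ ≤ 1)
    (hmix : ∀ s, ∑ s', |(P ^ τ) s s' - μ s'| ≤ β) (k : ℕ) :
    ∫ ω, ‖movingAverage β φ w₀ (fun i => X i ω) (k + τ + 1) - ∑ s, μ s • φ s‖ ^ 2 ∂ℙ
      ≤ (1 - β) ^ 2
          * ∫ ω, ‖movingAverage β φ w₀ (fun i => X i ω) (k + τ) - ∑ s, μ s • φ s‖ ^ 2 ∂ℙ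
        + (2 * β * (1 - β) * (4 * β * (τ + 1)) + 4 * β ^ 2) := by
  set c := ∑ s, μ s • φ s
  have integrable_sq (t : ℕ) :
      Integrable (fun ω => ‖movingAverage β φ w₀ (fun i => X i ω) t - c‖ ^ 2) ℙ :=
    hX.integrable_comp (F := fun x => ‖movingAverage β φ w₀ x t - c‖ ^ 2)
      fun x y hxy => congrArg (‖· - c‖ ^ 2) (dependsOn_movingAverage t hxy)
  have integrable_inner (t : ℕ) : Integrable (fun ω =>
      inner ℝ (φ (X t ω) - c) (movingAverage β φ w₀ (fun i => X i ω) t - c)) ℙ :=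
    hX.integrable_comp (F := fun x => inner ℝ (φ (x t) - c) (movingAverage β φ w₀ x t - c))
      fun x y hxy => congrArg₂ (fun s w => inner ℝ (φ s - c) (w - c))
        (hxy t Set.self_mem_Iic) (dependsOn_movingAverage t hxy)
  have norm_feature_sub_sq_le (s : S) : ‖φ s - c‖ ^ 2 ≤ 4 := by
    have hc : ‖c‖ ≤ 1 := norm_sum_smul_le_of_forall_le hμ.nonneg hμ.sum_one hφ
    nlinarith [norm_sub_le (φ s) c, norm_nonneg (φ s - c), hφ s]
  calc ∫ ω, ‖movingAverage β φ w₀ (fun i => X i ω) (k + τ + 1) - c‖ ^ 2 ∂ℙ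
      ≤ ∫ ω, ((1 - β) ^ 2 * ‖movingAverage β φ w₀ (fun i => X i ω) (k + τ) - c‖ ^ 2
          + 2 * β * (1 - β) * inner ℝ (φ (X (k + τ) ω) - c)
            (movingAverage β φ w₀ (fun i => X i ω) (k + τ) - c) + β ^ 2 * 4) ∂ℙ := by
        refine integral_mono (integrable_sq _) (by fun_prop) fun ω => ?_
        simp only [norm_movingAverage_succ_sub_sq c]
        gcongr
        exact norm_feature_sub_sq_le _
    _ = (1 - β) ^ 2 * ∫ ω, ‖movingAverage β φ w₀ (fun i => X i ω) (k + τ) - c‖ ^ 2 ∂ℙ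
          + 2 * β * (1 - β) * ∫ ω, inner ℝ (φ (X (k + τ) ω) - c)
            (movingAverage β φ w₀ (fun i => X i ω) (k + τ) - c) ∂ℙ + β ^ 2 * 4 := by
        rw [integral_add (by fun_prop) (by fun_prop), integral_add (by fun_prop) (by fun_prop),
          integral_const_mul, integral_const_mul]
        simp
    _ ≤ _ := by
        rw [mul_comm (β ^ 2), ← add_assoc]
        have : 0 ≤ 1 - β := sub_nonneg.2 hβ'
        gcongr
        exact hX.integral_inner_movingAverage_le hμ hβ hβ' hφ hw₀ hmix k

theorem IsMarkovChain.integral_norm_movingAverage_sub_sq_le (hX : IsMarkovChain ℙ P X)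
    (hμ : IsStationary P μ) (hβ : 0 ≤ β) (hβ' : β ≤ 1) (hφ : ∀ s, ‖φ s‖ ≤ 1) (hw₀ : ‖w₀‖ ≤ 1)
    (hmix : ∀ s, ∑ s', |(P ^ τ) s s' - μ s'| ≤ β) (k : ℕ) :
    ∫ ω, ‖movingAverage β φ w₀ (fun i => X i ω) (k + τ) - ∑ s, μ s • φ s‖ ^ 2 ∂ℙ
      ≤ 4 * ((1 - β) ^ 2) ^ k + β * (4 * τ + 6) := by
  have integral_zero_le :
      ∫ ω, ‖movingAverage β φ w₀ (fun i => X i ω) (0 + τ) - ∑ s, μ s • φ s‖ ^ 2 ∂ℙ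
        ≤ 4 + β * (4 * τ + 6) := by
    have hc : ‖∑ s, μ s • φ s‖ ≤ 1 := norm_sum_smul_le_of_forall_le hμ.nonneg hμ.sum_one hφ
    refine (integral_mono_of_nonneg (.of_forall fun _ => sq_nonneg _) (integrable_const 4)
      (.of_forall fun ω => ?_)).trans
      (by rw [integral_const, probReal_univ, one_smul]
          exact le_add_of_nonneg_right (by positivity))
    have hw := norm_movingAverage_le hβ hβ' hφ hw₀ (fun i => X i ω) (0 + τ)
    exact (pow_le_pow_left₀ (norm_nonneg _)
      ((norm_sub_le _ _).trans (add_le_add hw hc)) 2).trans_eq (by norm_num)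
  have fixed_point_le : (1 - β) ^ 2 * (β * (4 * τ + 6))
      + (2 * β * (1 - β) * (4 * β * (τ + 1)) + 4 * β ^ 2) ≤ β * (4 * τ + 6) := by
    have : 0 ≤ β ^ 3 * (2 + 4 * τ) := by positivity
    linarith
  simpa using le_of_linear_recurrence (b := 0)
    (u := fun k => ∫ ω, ‖movingAverage β φ w₀ (fun i => X i ω) (k + τ) - ∑ s, μ s • φ s‖ ^ 2 ∂ℙ)
    (sq_nonneg _) le_rfl le_rfl fixed_point_le integral_zero_le (fun k => by
      simpa [add_right_comm] using
        hX.integral_norm_movingAverage_succ_sub_sq_le hμ hβ hβ' hφ hw₀ hmix k) k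

end MovingAverage

section UpdateDirections

variable {S : Type*} {d : ℕ} {Φ : Matrix S (Fin d) ℝ} {R : S → ℝ} {r ϱ : ℝ}
  {w w' θ θ' : EuclideanSpace ℝ (Fin d)}

theorem inner_feature (s : S) (θ : EuclideanSpace ℝ (Fin d)) :
    inner ℝ (feature Φ s) θ = (Φ *ᵥ θ.ofLp) s := by
  simp [feature, PiLp.inner_apply, mulVec, dotProduct, mul_comm]

theorem abs_inner_feature_le (hΦ : ∀ s, ‖feature Φ s‖ ≤ 1) (hθ : ‖θ‖ ≤ ϱ) (s : S) :
    |inner ℝ (feature Φ s) θ| ≤ ϱ :=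
  (abs_real_inner_le_norm _ _).trans
    ((mul_le_of_le_one_left (norm_nonneg _) (hΦ s)).trans hθ)

theorem abs_add_inner_feature_le (hΦ : ∀ s, ‖feature Φ s‖ ≤ 1) (hR : ∀ s, |R s| ≤ r)
    (hθ : ‖θ‖ ≤ ϱ) (s : S) : |R s + inner ℝ (feature Φ s) θ| ≤ r + ϱ :=
  (abs_add_le _ _).trans (add_le_add (hR s) (abs_inner_feature_le hΦ hθ s))

theorem abs_temporalDifference_le (hΦ : ∀ s, ‖feature Φ s‖ ≤ 1) (hR : ∀ s, |R s| ≤ r)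
    (hθ : ‖θ‖ ≤ ϱ) (s s' : S) :
    |R s + inner ℝ (feature Φ s') θ - inner ℝ (feature Φ s) θ| ≤ r + 2 * ϱ := by
  have h := abs_le.1 (abs_inner_feature_le hΦ hθ s)
  have h' := abs_le.1 (abs_inner_feature_le hΦ hθ s')
  have hr := abs_le.1 (hR s)
  exact abs_le.2 ⟨by linarith, by linarith⟩

theorem norm_gUpdate_le (hΦ : ∀ s, ‖feature Φ s‖ ≤ 1) (hR : ∀ s, |R s| ≤ r) (hw : ‖w‖ ≤ 1)
    (hθ : ‖θ‖ ≤ ϱ) (s s' : S) : ‖gUpdate Φ R s s' w θ‖ ≤ 2 * r + 3 * ϱ :=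
  calc ‖gUpdate Φ R s s' w θ‖
      ≤ |R s + inner ℝ (feature Φ s') θ - inner ℝ (feature Φ s) θ| * ‖feature Φ s‖
        + |R s + inner ℝ (feature Φ s) θ| * ‖w‖ :=
        (norm_sub_le _ _).trans_eq (by simp only [norm_smul, Real.norm_eq_abs])
    _ ≤ (r + 2 * ϱ) + (r + ϱ) := add_le_add
        ((mul_le_of_le_one_right (abs_nonneg _) (hΦ s)).trans
          (abs_temporalDifference_le hΦ hR hθ s s'))
        ((mul_le_of_le_one_right (abs_nonneg _) hw).trans (abs_add_inner_feature_le hΦ hR hθ s))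
    _ = 2 * r + 3 * ϱ := by ring

theorem norm_gUpdate_sub_le (hΦ : ∀ s, ‖feature Φ s‖ ≤ 1) (hR : ∀ s, |R s| ≤ r)
    (hw : ‖w‖ ≤ 1) (hθ' : ‖θ'‖ ≤ ϱ) (s s' : S) :
    ‖gUpdate Φ R s s' w θ - gUpdate Φ R s s' w' θ'‖
      ≤ 3 * ‖θ - θ'‖ + (r + ϱ) * ‖w - w'‖ := by
  have sub_eq : gUpdate Φ R s s' w θ - gUpdate Φ R s s' w' θ'
      = gUpdate Φ 0 s s' w (θ - θ') - (R s + inner ℝ (feature Φ s) θ') • (w - w') := by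
    simp only [gUpdate, inner_sub_right, Pi.zero_apply]
    module
  have homogeneous_le : ‖gUpdate Φ 0 s s' w (θ - θ')‖ ≤ 3 * ‖θ - θ'‖ := by
    simpa using norm_gUpdate_le (r := 0) hΦ (by simp) hw le_rfl s s'
  calc ‖gUpdate Φ R s s' w θ - gUpdate Φ R s s' w' θ'‖
      ≤ ‖gUpdate Φ 0 s s' w (θ - θ')‖ + |R s + inner ℝ (feature Φ s) θ'| * ‖w - w'‖ := by
        rw [sub_eq, ← Real.norm_eq_abs, ← norm_smul]
        exact norm_sub_le _ _
    _ ≤ 3 * ‖θ - θ'‖ + (r + ϱ) * ‖w - w'‖ := by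
        gcongr
        exact abs_add_inner_feature_le hΦ hR hθ' s

variable [Fintype S] {μ : S → ℝ}

theorem toLp_transpose_mulVec (v : S → ℝ) :
    (WithLp.toLp 2 (Φᵀ *ᵥ v) : EuclideanSpace ℝ (Fin d)) = ∑ s, v s • feature Φ s := by
  ext i
  simp [feature, mulVec, dotProduct, mul_comm]

theorem wStar_eq_sum : wStar Φ μ = ∑ s, μ s • feature Φ s :=
  toLp_transpose_mulVec μ

/-- The conditional mean `∑ s', P s s' • gUpdate Φ R s s' w θ` of the update direction given the
current state, which averages out the successor state before mixing is used. -/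
noncomputable def gMean (P : Matrix S S ℝ) (Φ : Matrix S (Fin d) ℝ) (R : S → ℝ) (s : S)
    (w θ : EuclideanSpace ℝ (Fin d)) : EuclideanSpace ℝ (Fin d) :=
  ∑ s', P s s' • gUpdate Φ R s s' w θ

variable [DecidableEq S] {P : Matrix S S ℝ}

theorem gMean_eq (hP : P ∈ rowStochastic ℝ S) (s : S) (w θ : EuclideanSpace ℝ (Fin d)) :
    gMean P Φ R s w θ = (R s + (P *ᵥ (Φ *ᵥ θ.ofLp)) s - (Φ *ᵥ θ.ofLp) s) • feature Φ s
      - (R s + (Φ *ᵥ θ.ofLp) s) • w := by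
  have sum_mul_const (a : ℝ) : ∑ s', P s s' * a = a := by
    rw [← Finset.sum_mul, sum_row_of_mem_rowStochastic hP, one_mul]
  simp only [gMean, gUpdate, inner_feature, smul_sub, smul_smul, Finset.sum_sub_distrib,
    ← Finset.sum_smul, mul_sub, mul_add, Finset.sum_add_distrib, sum_mul_const]
  rfl

theorem gBar_eq_sum (hP : P ∈ rowStochastic ℝ S) (w θ : EuclideanSpace ℝ (Fin d)) :
    gBar P μ Φ R w θ = ∑ s, μ s • gMean P Φ R s w θ := by
  simp only [gBar, gMean_eq hP, smul_sub, smul_smul, Finset.sum_sub_distrib,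
    toLp_transpose_mulVec, mulVec_diagonal, dotProduct, Finset.sum_smul, Pi.add_apply,
    Pi.sub_apply]

theorem norm_gMean_le (hP : P ∈ rowStochastic ℝ S) (hΦ : ∀ s, ‖feature Φ s‖ ≤ 1)
    (hR : ∀ s, |R s| ≤ r) (hw : ‖w‖ ≤ 1) (hθ : ‖θ‖ ≤ ϱ) (s : S) :
    ‖gMean P Φ R s w θ‖ ≤ 2 * r + 3 * ϱ :=
  norm_sum_smul_le_of_forall_le (hP.1 s) (sum_row_of_mem_rowStochastic hP s)
    (norm_gUpdate_le hΦ hR hw hθ s)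

theorem norm_gMean_sub_le (hP : P ∈ rowStochastic ℝ S) (hΦ : ∀ s, ‖feature Φ s‖ ≤ 1)
    (hR : ∀ s, |R s| ≤ r) (hw : ‖w‖ ≤ 1) (hθ' : ‖θ'‖ ≤ ϱ) (s : S) :
    ‖gMean P Φ R s w θ - gMean P Φ R s w' θ'‖ ≤ 3 * ‖θ - θ'‖ + (r + ϱ) * ‖w - w'‖ := by
  simp only [gMean, ← Finset.sum_sub_distrib, ← smul_sub]
  exact norm_sum_smul_le_of_forall_le (hP.1 s) (sum_row_of_mem_rowStochastic hP s)
    (norm_gUpdate_sub_le hΦ hR hw hθ' s)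

theorem norm_gBar_le (hP : P ∈ rowStochastic ℝ S) (hμ : IsStationary P μ)
    (hΦ : ∀ s, ‖feature Φ s‖ ≤ 1) (hR : ∀ s, |R s| ≤ r) (hw : ‖w‖ ≤ 1) (hθ : ‖θ‖ ≤ ϱ) :
    ‖gBar P μ Φ R w θ‖ ≤ 2 * r + 3 * ϱ := by
  rw [gBar_eq_sum hP]
  exact norm_sum_smul_le_of_forall_le hμ.nonneg hμ.sum_one (norm_gMean_le hP hΦ hR hw hθ)

theorem norm_gBar_sub_le (hP : P ∈ rowStochastic ℝ S) (hμ : IsStationary P μ)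
    (hΦ : ∀ s, ‖feature Φ s‖ ≤ 1) (hR : ∀ s, |R s| ≤ r) (hw : ‖w‖ ≤ 1) (hθ' : ‖θ'‖ ≤ ϱ) :
    ‖gBar P μ Φ R w θ - gBar P μ Φ R w' θ'‖ ≤ 3 * ‖θ - θ'‖ + (r + ϱ) * ‖w - w'‖ := by
  simp only [gBar_eq_sum hP, ← Finset.sum_sub_distrib, ← smul_sub]
  exact norm_sum_smul_le_of_forall_le hμ.nonneg hμ.sum_one (norm_gMean_sub_le hP hΦ hR hw hθ')

end UpdateDirections

section Drift

variable {S : Type*} [Fintype S] {d : ℕ} {Φ : Matrix S (Fin d) ℝ}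
  {R : S → ℝ} {P : Matrix S S ℝ} {μ : S → ℝ} {r ϱ : ℝ}

theorem dirichletSq_smul (c : ℝ) (f : S → ℝ) :
    dirichletSq P μ (c • f) = c ^ 2 * dirichletSq P μ f := by
  simp only [dirichletSq, Pi.smul_apply, smul_eq_mul, ← mul_sub, mul_pow,
    mul_left_comm _ (c ^ 2), ← Finset.mul_sum]

theorem IsStationary.sum_mul_mulVec (hμ : IsStationary P μ) (f : S → ℝ) :
    ∑ s, μ s * (P *ᵥ f) s = ∑ s, μ s * f s :=
  (dotProduct_mulVec μ P f).trans (congrArg (· ⬝ᵥ f) hμ.vecMul_eq)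

theorem abs_dotProduct_add_mulVec_le (hμ : IsStationary P μ) (hΦ : ∀ s, ‖feature Φ s‖ ≤ 1)
    (hR : ∀ s, |R s| ≤ r) {θ : EuclideanSpace ℝ (Fin d)} (hθ : ‖θ‖ ≤ ϱ) :
    |μ ⬝ᵥ (R + Φ *ᵥ θ.ofLp)| ≤ r + ϱ := by
  refine norm_sum_smul_le_of_forall_le (E := ℝ) hμ.nonneg hμ.sum_one fun s => ?_
  rw [Pi.add_apply, ← inner_feature]
  exact abs_add_inner_feature_le hΦ hR hθ s

variable [DecidableEq S]

theorem dirichletSq_nonneg (hP : P ∈ rowStochastic ℝ S) (hμ : IsStationary P μ) (f : S → ℝ) :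
    0 ≤ dirichletSq P μ f :=
  mul_nonneg (by norm_num) (Finset.sum_nonneg fun s _ => Finset.sum_nonneg fun s' _ =>
    mul_nonneg (mul_nonneg (hμ.nonneg s) (hP.1 s s')) (sq_nonneg _))

theorem dirichletSq_eq (hP : P ∈ rowStochastic ℝ S) (hμ : IsStationary P μ) (f : S → ℝ) :
    dirichletSq P μ f = ∑ s, μ s * (f s ^ 2 - f s * (P *ᵥ f) s) := by
  have sum_row (s : S) : ∑ s', μ s * P s s' * (f s - f s') ^ 2
      = μ s * f s ^ 2 + μ s * (P *ᵥ fun s' => f s' ^ 2) s - 2 * (μ s * (f s * (P *ᵥ f) s)) :=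
    calc ∑ s', μ s * P s s' * (f s - f s') ^ 2
        = ∑ s', (μ s * f s ^ 2 * P s s' + μ s * (P s s' * f s' ^ 2)
            - 2 * (μ s * f s) * (P s s' * f s')) := Finset.sum_congr rfl fun s' _ => by ring
      _ = _ := by
        rw [Finset.sum_sub_distrib, Finset.sum_add_distrib, ← Finset.mul_sum, ← Finset.mul_sum,
          ← Finset.mul_sum, sum_row_of_mem_rowStochastic hP]
        simp only [mulVec, dotProduct]
        ring
  rw [dirichletSq, Finset.sum_congr rfl fun s _ => sum_row s, Finset.sum_sub_distrib,
    Finset.sum_add_distrib, hμ.sum_mul_mulVec, ← Finset.mul_sum]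
  simp only [mul_sub, Finset.sum_sub_distrib]
  ring

theorem eta_mul_norm_sq_le (hP : P ∈ rowStochastic ℝ S) (hμ : IsStationary P μ)
    (e : EuclideanSpace ℝ (Fin d)) :
    eta P μ Φ * ‖e‖ ^ 2 ≤ dirichletSq P μ (Φ *ᵥ e.ofLp) + (μ ⬝ᵥ (Φ *ᵥ e.ofLp)) ^ 2 := by
  set F : EuclideanSpace ℝ (Fin d) → ℝ :=
    fun x => dirichletSq P μ (Φ *ᵥ x.ofLp) + (μ ⬝ᵥ (Φ *ᵥ x.ofLp)) ^ 2
  have F_nonneg (x) : 0 ≤ F x := add_nonneg (dirichletSq_nonneg hP hμ _) (sq_nonneg _)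
  have F_smul (c : ℝ) (x) : F (c • x) = c ^ 2 * F x := by
    simp only [F, WithLp.ofLp_smul, mulVec_smul, dirichletSq_smul, dotProduct_smul, smul_eq_mul]
    ring
  rcases eq_or_ne e 0 with rfl | he
  · simpa [F] using F_nonneg 0
  · have norm_pos : 0 < ‖e‖ := norm_pos_iff.2 he
    have eta_le : eta P μ Φ ≤ F (‖e‖⁻¹ • e) :=
      csInf_le ⟨0, Set.forall_mem_image.2 fun x _ => F_nonneg x⟩
        (Set.mem_image_of_mem F (by simp [norm_smul, norm_pos.ne']))
    rw [F_smul, inv_pow, inv_mul_eq_div] at eta_le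
    exact (le_div_iff₀ (by positivity)).1 eta_le

theorem gBar_sub_gBar (w θ θ' : EuclideanSpace ℝ (Fin d)) :
    gBar P μ Φ R w θ - gBar P μ Φ R w θ' = gBar P μ Φ 0 w (θ - θ') := by
  simp only [gBar, WithLp.ofLp_sub, mulVec_sub, mulVec_add, dotProduct_add, dotProduct_sub,
    WithLp.toLp_sub, WithLp.toLp_add, zero_add]
  module

theorem gBar_eq_sub_smul (w w' θ : EuclideanSpace ℝ (Fin d)) :
    gBar P μ Φ R w θ = gBar P μ Φ R w' θ - (μ ⬝ᵥ (R + Φ *ᵥ θ.ofLp)) • (w - w') := by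
  simp only [gBar]
  module

theorem inner_gBar_zero_wStar (hP : P ∈ rowStochastic ℝ S) (hμ : IsStationary P μ)
    (e : EuclideanSpace ℝ (Fin d)) :
    inner ℝ e (gBar P μ Φ 0 (wStar Φ μ) e)
      = -(dirichletSq P μ (Φ *ᵥ e.ofLp) + (μ ⬝ᵥ (Φ *ᵥ e.ofLp)) ^ 2) := by
  have inner_toLp (v : S → ℝ) :
      inner ℝ e (WithLp.toLp 2 (Φᵀ *ᵥ v)) = ∑ s, v s * (Φ *ᵥ e.ofLp) s := by
    simp only [toLp_transpose_mulVec, inner_sum, inner_smul_right,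
      real_inner_comm (feature Φ _) e, inner_feature]
  have drift_eq : ∑ s, (diagonal μ *ᵥ (P *ᵥ (Φ *ᵥ e.ofLp) - Φ *ᵥ e.ofLp)) s * (Φ *ᵥ e.ofLp) s
      = -dirichletSq P μ (Φ *ᵥ e.ofLp) := by
    rw [dirichletSq_eq hP hμ, ← Finset.sum_neg_distrib]
    refine Finset.sum_congr rfl fun s _ => ?_
    rw [mulVec_diagonal, Pi.sub_apply]
    ring
  rw [gBar, wStar, zero_add, zero_add, inner_sub_right, inner_smul_right, inner_toLp, inner_toLp,
    drift_eq, dotProduct]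
  ring

end Drift

/-- A row-stochastic matrix with a stationary distribution, features in the unit ball and rewards
bounded by `r`: all that the error analysis needs to know of the decision process. -/
structure IsBoundedModel {S : Type*} [Fintype S] [DecidableEq S] {d : ℕ} (P : Matrix S S ℝ)
    (μ : S → ℝ) (Φ : Matrix S (Fin d) ℝ) (R : S → ℝ) (r : ℝ) : Prop where
  stochastic : P ∈ rowStochastic ℝ S
  stationary : IsStationary P μ
  norm_feature_le : ∀ s, ‖feature Φ s‖ ≤ 1
  abs_reward_le : ∀ s, |R s| ≤ r

section BoundedModel

variable {S : Type*} [Fintype S] [DecidableEq S] {d : ℕ} {Φ : Matrix S (Fin d) ℝ} {R : S → ℝ}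
  {P : Matrix S S ℝ} {μ : S → ℝ} {r ϱ : ℝ} {θstar w w' θ θ' : EuclideanSpace ℝ (Fin d)}

theorem IsBoundedModel.nonneg (h : IsBoundedModel P μ Φ R r) : 0 ≤ r := by
  obtain ⟨s, -⟩ : ∃ s ∈ Finset.univ, μ s ≠ 0 :=
    Finset.exists_ne_zero_of_sum_ne_zero (h.stationary.sum_one.trans_ne one_ne_zero)
  exact (abs_nonneg _).trans (h.abs_reward_le s)

theorem IsBoundedModel.norm_wStar_le (h : IsBoundedModel P μ Φ R r) : ‖wStar Φ μ‖ ≤ 1 := by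
  rw [wStar_eq_sum]
  exact norm_sum_smul_le_of_forall_le h.stationary.nonneg h.stationary.sum_one h.norm_feature_le

theorem IsBoundedModel.two_mul_inner_gBar_le (h : IsBoundedModel P μ Φ R r)
    (hroot : gBar P μ Φ R (wStar Φ μ) θstar = 0) (hθ : ‖θ‖ ≤ ϱ) :
    2 * inner ℝ (θ - θstar) (gBar P μ Φ R w θ)
      ≤ -2 * eta P μ Φ * ‖θ - θstar‖ ^ 2
        + (r + 2 * ϱ) * (2 * ‖θ - θstar‖ * ‖w - wStar Φ μ‖) := by
  set a := μ ⬝ᵥ (R + Φ *ᵥ θ.ofLp)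
  have ha : |a| ≤ r + 2 * ϱ :=
    (abs_dotProduct_add_mulVec_le h.stationary h.norm_feature_le h.abs_reward_le hθ).trans
      (by linarith [norm_nonneg θ])
  have gBar_eq : gBar P μ Φ R w θ
      = gBar P μ Φ 0 (wStar Φ μ) (θ - θstar) - a • (w - wStar Φ μ) := by
    rw [gBar_eq_sub_smul w (wStar Φ μ), ← gBar_sub_gBar (R := R), hroot, sub_zero]
  have drift_le : inner ℝ (θ - θstar) (gBar P μ Φ 0 (wStar Φ μ) (θ - θstar))
      ≤ -(eta P μ Φ * ‖θ - θstar‖ ^ 2) := by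
    rw [inner_gBar_zero_wStar h.stochastic h.stationary]
    exact neg_le_neg (eta_mul_norm_sq_le h.stochastic h.stationary _)
  have cross_le : -(a * inner ℝ (θ - θstar) (w - wStar Φ μ))
      ≤ (r + 2 * ϱ) * (‖θ - θstar‖ * ‖w - wStar Φ μ‖) :=
    calc -(a * inner ℝ (θ - θstar) (w - wStar Φ μ))
        ≤ |a| * |inner ℝ (θ - θstar) (w - wStar Φ μ)| := by
          rw [← abs_mul]
          exact neg_le_abs _
      _ ≤ (r + 2 * ϱ) * (‖θ - θstar‖ * ‖w - wStar Φ μ‖) :=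
          mul_le_mul ha (abs_real_inner_le_norm _ _) (abs_nonneg _) ((abs_nonneg a).trans ha)
  rw [gBar_eq, inner_sub_right, inner_smul_right]
  linarith

/-- The deviation of the expected update direction in state `s` from its stationary mean, as it
enters the recursion for `‖θ - θ*‖²`. -/
noncomputable def tdNoise (P : Matrix S S ℝ) (μ : S → ℝ) (Φ : Matrix S (Fin d) ℝ) (R : S → ℝ)
    (θstar : EuclideanSpace ℝ (Fin d)) (s : S) (w θ : EuclideanSpace ℝ (Fin d)) : ℝ :=
  inner ℝ (θ - θstar) (gMean P Φ R s w θ - gBar P μ Φ R w θ)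

theorem IsBoundedModel.two_mul_inner_gMean_le (h : IsBoundedModel P μ Φ R r)
    (hroot : gBar P μ Φ R (wStar Φ μ) θstar = 0) (hθ : ‖θ‖ ≤ ϱ) {ε : ℝ} (hε : 0 < ε) (s : S) :
    2 * inner ℝ (θ - θstar) (gMean P Φ R s w θ)
      ≤ -2 * (eta P μ Φ - ε * (r + 2 * ϱ) / 2) * ‖θ - θstar‖ ^ 2
        + (r + 2 * ϱ) / ε * ‖w - wStar Φ μ‖ ^ 2 + 2 * tdNoise P μ Φ R θstar s w θ := by
  have hr := h.nonneg
  have hϱ : 0 ≤ ϱ := (norm_nonneg θ).trans hθ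
  have young : (r + 2 * ϱ) * (2 * ‖θ - θstar‖ * ‖w - wStar Φ μ‖)
      ≤ (r + 2 * ϱ) * (ε * ‖θ - θstar‖ ^ 2 + ε⁻¹ * ‖w - wStar Φ μ‖ ^ 2) := by
    gcongr
    exact two_mul_le_add_mul_sq hε
  have drift_le := h.two_mul_inner_gBar_le hroot (w := w) hθ
  rw [tdNoise, inner_sub_right, div_eq_mul_inv (r + 2 * ϱ) ε]
  linarith

theorem IsBoundedModel.sum_mul_tdNoise (h : IsBoundedModel P μ Φ R r)
    (w θ : EuclideanSpace ℝ (Fin d)) : ∑ s, μ s * tdNoise P μ Φ R θstar s w θ = 0 := by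
  simp only [tdNoise, ← inner_smul_right, ← inner_sum, smul_sub, Finset.sum_sub_distrib,
    ← Finset.sum_smul, h.stationary.sum_one, one_smul, gBar_eq_sum h.stochastic, sub_self,
    inner_zero_right]

theorem IsBoundedModel.norm_gMean_sub_gBar_le (h : IsBoundedModel P μ Φ R r) (hw : ‖w‖ ≤ 1)
    (hθ : ‖θ‖ ≤ ϱ) (s : S) :
    ‖gMean P Φ R s w θ - gBar P μ Φ R w θ‖ ≤ 2 * (2 * r + 3 * ϱ) :=
  (norm_sub_le _ _).trans <| (add_le_add
    (norm_gMean_le h.stochastic h.norm_feature_le h.abs_reward_le hw hθ s)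
    (norm_gBar_le h.stochastic h.stationary h.norm_feature_le h.abs_reward_le hw hθ)).trans_eq
    (two_mul _).symm

theorem IsBoundedModel.abs_tdNoise_le (h : IsBoundedModel P μ Φ R r) (hθstar : ‖θstar‖ ≤ ϱ)
    (hw : ‖w‖ ≤ 1) (hθ : ‖θ‖ ≤ ϱ) (s : S) :
    |tdNoise P μ Φ R θstar s w θ| ≤ 4 * ϱ * (2 * r + 3 * ϱ) :=
  calc |tdNoise P μ Φ R θstar s w θ|
      ≤ ‖θ - θstar‖ * ‖gMean P Φ R s w θ - gBar P μ Φ R w θ‖ := abs_real_inner_le_norm _ _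
    _ ≤ 2 * ϱ * (2 * (2 * r + 3 * ϱ)) :=
        mul_le_mul (norm_sub_le_two_mul hθ hθstar) (h.norm_gMean_sub_gBar_le hw hθ s)
          (norm_nonneg _) (by linarith [norm_nonneg θ])
    _ = 4 * ϱ * (2 * r + 3 * ϱ) := by ring

theorem IsBoundedModel.tdNoise_sub_le (h : IsBoundedModel P μ Φ R r) (hθstar : ‖θstar‖ ≤ ϱ)
    (hw : ‖w‖ ≤ 1) (hθ : ‖θ‖ ≤ ϱ) (hθ' : ‖θ'‖ ≤ ϱ) (s : S) :
    tdNoise P μ Φ R θstar s w θ - tdNoise P μ Φ R θstar s w' θ'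
      ≤ (4 * r + 18 * ϱ) * ‖θ - θ'‖ + 4 * ϱ * (r + ϱ) * ‖w - w'‖ := by
  set g := gMean P Φ R s w θ - gBar P μ Φ R w θ
  set Δ := gMean P Φ R s w θ - gMean P Φ R s w' θ' - (gBar P μ Φ R w θ - gBar P μ Φ R w' θ')
  have sub_eq : tdNoise P μ Φ R θstar s w θ - tdNoise P μ Φ R θstar s w' θ'
      = inner ℝ (θ - θ') g + inner ℝ (θ' - θstar) Δ := by
    simp only [tdNoise, g, Δ, inner_sub_right, inner_sub_left]
    ring
  have norm_Δ_le : ‖Δ‖ ≤ 2 * (3 * ‖θ - θ'‖ + (r + ϱ) * ‖w - w'‖) :=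
    (norm_sub_le _ _).trans <| (add_le_add
      (norm_gMean_sub_le h.stochastic h.norm_feature_le h.abs_reward_le hw hθ' s)
      (norm_gBar_sub_le h.stochastic h.stationary h.norm_feature_le h.abs_reward_le hw
        hθ')).trans_eq (two_mul _).symm
  calc tdNoise P μ Φ R θstar s w θ - tdNoise P μ Φ R θstar s w' θ'
      ≤ ‖θ - θ'‖ * ‖g‖ + ‖θ' - θstar‖ * ‖Δ‖ := by
        rw [sub_eq]
        exact add_le_add (real_inner_le_norm _ _) (real_inner_le_norm _ _)
    _ ≤ ‖θ - θ'‖ * (2 * (2 * r + 3 * ϱ))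
        + 2 * ϱ * (2 * (3 * ‖θ - θ'‖ + (r + ϱ) * ‖w - w'‖)) := by
        gcongr
        · exact h.norm_gMean_sub_gBar_le hw hθ s
        · linarith [norm_nonneg θ]
        · exact norm_sub_le_two_mul hθ' hθstar
    _ = (4 * r + 18 * ϱ) * ‖θ - θ'‖ + 4 * ϱ * (r + ϱ) * ‖w - w'‖ := by ring

end BoundedModel

/-- Admissible parameters of the algorithm: the parameter iterate moves at least as fast as the
auxiliary one (`β ≤ α`), and the projection of the auxiliary iterate is never active. -/
structure IsAdmissible {d : ℕ} (α β Rw ϱ : ℝ) (w₀ θ₀ : EuclideanSpace ℝ (Fin d)) : Prop where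
  beta_nonneg : 0 ≤ β
  beta_le_one : β ≤ 1
  beta_le_alpha : β ≤ α
  one_le_radius : 1 ≤ Rw
  norm_init_fst_le : ‖w₀‖ ≤ 1
  norm_init_snd_le : ‖θ₀‖ ≤ ϱ

section Trajectory

variable {S : Type*} {d : ℕ} {Φ : Matrix S (Fin d) ℝ} {R : S → ℝ} {α β Rw ϱ r : ℝ}
  {w₀ θ₀ θstar : EuclideanSpace ℝ (Fin d)}

local notation "𝒵" => singleChain Φ R α β Rw ϱ w₀ θ₀

theorem dependsOn_singleChain (t : ℕ) : DependsOn (𝒵 · t) (Set.Iic t) := by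
  induction t with
  | zero => exact fun _ _ _ => rfl
  | succ t ih =>
    intro x y hxy
    have iterate_eq : 𝒵 x t = 𝒵 y t :=
      ih fun i hi => hxy i (Set.Iic_subset_Iic.2 (Nat.le_succ t) hi)
    simp only [singleChain, iterate_eq, hxy t (Nat.le_succ t), hxy (t + 1) Set.self_mem_Iic]

theorem IsAdmissible.alpha_nonneg (h : IsAdmissible α β Rw ϱ w₀ θ₀) : 0 ≤ α :=
  h.beta_nonneg.trans h.beta_le_alpha

theorem IsAdmissible.radius_nonneg (h : IsAdmissible α β Rw ϱ w₀ θ₀) : 0 ≤ ϱ :=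
  (norm_nonneg _).trans h.norm_init_snd_le

theorem IsAdmissible.singleChain_fst (h : IsAdmissible α β Rw ϱ w₀ θ₀)
    (hΦ : ∀ s, ‖feature Φ s‖ ≤ 1) (x : ℕ → S) (t : ℕ) :
    (𝒵 x t).1 = movingAverage β (feature Φ) w₀ x t := by
  induction t with
  | zero => rfl
  | succ t ih =>
    simp only [singleChain, fUpdate, ih]
    exact projBall_of_norm_le ((norm_movingAverage_le h.beta_nonneg h.beta_le_one hΦ
      h.norm_init_fst_le x (t + 1)).trans h.one_le_radius)

theorem IsAdmissible.norm_singleChain_fst_le (h : IsAdmissible α β Rw ϱ w₀ θ₀)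
    (hΦ : ∀ s, ‖feature Φ s‖ ≤ 1) (x : ℕ → S) (t : ℕ) : ‖(𝒵 x t).1‖ ≤ 1 := by
  rw [h.singleChain_fst hΦ]
  exact norm_movingAverage_le h.beta_nonneg h.beta_le_one hΦ h.norm_init_fst_le x t

theorem norm_singleChain_snd_le (hθ₀ : ‖θ₀‖ ≤ ϱ) (x : ℕ → S) (t : ℕ) : ‖(𝒵 x t).2‖ ≤ ϱ := by
  cases t with
  | zero => exact hθ₀
  | succ t => exact norm_projBall_le ((norm_nonneg _).trans hθ₀) _

theorem IsAdmissible.norm_singleChain_fst_add_sub_le (h : IsAdmissible α β Rw ϱ w₀ θ₀)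
    (hΦ : ∀ s, ‖feature Φ s‖ ≤ 1) (x : ℕ → S) (t k : ℕ) :
    ‖(𝒵 x (t + k)).1 - (𝒵 x t).1‖ ≤ 2 * β * k := by
  simp only [h.singleChain_fst hΦ]
  exact norm_movingAverage_add_sub_le h.beta_nonneg h.beta_le_one hΦ h.norm_init_fst_le x t k

theorem IsAdmissible.norm_singleChain_snd_add_sub_le (h : IsAdmissible α β Rw ϱ w₀ θ₀)
    (hΦ : ∀ s, ‖feature Φ s‖ ≤ 1) (hR : ∀ s, |R s| ≤ r) (x : ℕ → S) (t k : ℕ) :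
    ‖(𝒵 x (t + k)).2 - (𝒵 x t).2‖ ≤ α * (2 * r + 3 * ϱ) * k := by
  refine norm_add_sub_le_mul (u := fun n => (𝒵 x n).2) (fun n => ?_) t k
  have hθ := norm_singleChain_snd_le (Φ := Φ) (R := R) (α := α) (β := β) (Rw := Rw) (w₀ := w₀)
    h.norm_init_snd_le x n
  refine (norm_projBall_sub_le _ hθ).trans ?_
  rw [add_sub_cancel_left, norm_smul, Real.norm_of_nonneg h.alpha_nonneg]
  exact mul_le_mul_of_nonneg_left
    (norm_gUpdate_le hΦ hR (h.norm_singleChain_fst_le hΦ x n) hθ _ _) h.alpha_nonneg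

theorem norm_singleChain_snd_succ_sub_sq_le (hθstar : ‖θstar‖ ≤ ϱ) (x : ℕ → S) (t : ℕ) :
    ‖(𝒵 x (t + 1)).2 - θstar‖ ^ 2 ≤ ‖(𝒵 x t).2 - θstar‖ ^ 2
      + α * (2 * inner ℝ ((𝒵 x t).2 - θstar)
        (gUpdate Φ R (x t) (x (t + 1)) (𝒵 x t).1 (𝒵 x t).2))
      + α ^ 2 * ‖gUpdate Φ R (x t) (x (t + 1)) (𝒵 x t).1 (𝒵 x t).2‖ ^ 2 := by
  have norm_le : ‖(𝒵 x (t + 1)).2 - θstar‖ ≤ _ := norm_projBall_sub_le _ hθstar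
  refine (pow_le_pow_left₀ (norm_nonneg _) norm_le 2).trans_eq ?_
  rw [add_sub_right_comm, norm_add_sq_real, inner_smul_right, norm_smul, mul_pow,
    Real.norm_eq_abs, sq_abs]
  ring

end Trajectory

section MeanSquare

variable {S Ω : Type*} [MeasurableSpace Ω] {ℙ : Measure Ω} [IsProbabilityMeasure ℙ]
  {d : ℕ} {Φ : Matrix S (Fin d) ℝ} {R : S → ℝ} {P : Matrix S S ℝ} {X : ℕ → Ω → S}
  {α β Rw ϱ : ℝ} {w₀ θ₀ θstar : EuclideanSpace ℝ (Fin d)}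

local notation "𝒵" => singleChain Φ R α β Rw ϱ w₀ θ₀

theorem IsMarkovChain.integrable_comp_singleChain [Finite S] (hX : IsMarkovChain ℙ P X)
    (f : S → EuclideanSpace ℝ (Fin d) × EuclideanSpace ℝ (Fin d) → ℝ) (t : ℕ) :
    Integrable (fun ω => f (X t ω) (𝒵 (X · ω) t)) ℙ :=
  hX.integrable_comp (F := fun x => f (x t) (𝒵 x t)) fun _ _ hxy =>
    congrArg₂ f (hxy t Set.self_mem_Iic) (dependsOn_singleChain t hxy)

theorem IsMarkovChain.integrable_inner_gUpdate [Finite S] (hX : IsMarkovChain ℙ P X) (t : ℕ) :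
    Integrable (fun ω => inner ℝ ((𝒵 (X · ω) t).2 - θstar)
      (gUpdate Φ R (X t ω) (X (t + 1) ω) (𝒵 (X · ω) t).1 (𝒵 (X · ω) t).2)) ℙ :=
  hX.integrable_comp (n := t + 1) (F := fun x => inner ℝ ((𝒵 x t).2 - θstar)
    (gUpdate Φ R (x t) (x (t + 1)) (𝒵 x t).1 (𝒵 x t).2)) fun x y hxy => by
      have iterate_eq : 𝒵 x t = 𝒵 y t :=
        dependsOn_singleChain t fun i hi => hxy i (Set.Iic_subset_Iic.2 (Nat.le_succ t) hi)
      simp only [iterate_eq, hxy t (Nat.le_succ t), hxy (t + 1) Set.self_mem_Iic]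

variable [Fintype S]

theorem IsMarkovChain.integral_inner_gUpdate (hX : IsMarkovChain ℙ P X) (t : ℕ) :
    ∫ ω, inner ℝ ((𝒵 (X · ω) t).2 - θstar)
        (gUpdate Φ R (X t ω) (X (t + 1) ω) (𝒵 (X · ω) t).1 (𝒵 (X · ω) t).2) ∂ℙ
      = ∫ ω, inner ℝ ((𝒵 (X · ω) t).2 - θstar)
        (gMean P Φ R (X t ω) (𝒵 (X · ω) t).1 (𝒵 (X · ω) t).2) ∂ℙ := by
  let H (s : S) (x : ℕ → S) : ℝ :=
    inner ℝ ((𝒵 x t).2 - θstar) (gUpdate Φ R (x t) s (𝒵 x t).1 (𝒵 x t).2)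
  have hH (s : S) : DependsOn (H s) (Set.Iic t) := fun x y hxy => by
    have iterate_eq : 𝒵 x t = 𝒵 y t := dependsOn_singleChain t hxy
    simp only [H, iterate_eq, hxy t Set.self_mem_Iic]
  refine (hX.integral_comp_succ hH).trans ?_
  simp only [H, gMean, inner_sum, inner_smul_right]

variable [DecidableEq S] {μ : S → ℝ} {r : ℝ}

theorem IsBoundedModel.integral_norm_singleChain_snd_succ_sub_sq_le_gMean
    (h : IsBoundedModel P μ Φ R r) (hX : IsMarkovChain ℙ P X)
    (hadm : IsAdmissible α β Rw ϱ w₀ θ₀) (hθstar : ‖θstar‖ ≤ ϱ) (t : ℕ) :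
    ∫ ω, ‖(𝒵 (X · ω) (t + 1)).2 - θstar‖ ^ 2 ∂ℙ
      ≤ ∫ ω, ‖(𝒵 (X · ω) t).2 - θstar‖ ^ 2 ∂ℙ
        + α * (2 * ∫ ω, inner ℝ ((𝒵 (X · ω) t).2 - θstar)
          (gMean P Φ R (X t ω) (𝒵 (X · ω) t).1 (𝒵 (X · ω) t).2) ∂ℙ)
        + 4 * α ^ 2 * (r + 3 * ϱ) ^ 2 := by
  have integrable_sq (t : ℕ) : Integrable (fun ω => ‖(𝒵 (X · ω) t).2 - θstar‖ ^ 2) ℙ :=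
    hX.integrable_comp_singleChain (fun _ z => ‖z.2 - θstar‖ ^ 2) t
  have integrable_inner := hX.integrable_inner_gUpdate (Φ := Φ) (R := R) (α := α) (β := β)
    (Rw := Rw) (ϱ := ϱ) (w₀ := w₀) (θ₀ := θ₀) (θstar := θstar) t
  have norm_gUpdate_le_two_mul (x : ℕ → S) :
      ‖gUpdate Φ R (x t) (x (t + 1)) (𝒵 x t).1 (𝒵 x t).2‖ ≤ 2 * (r + 3 * ϱ) :=
    (norm_gUpdate_le h.norm_feature_le h.abs_reward_le
      (hadm.norm_singleChain_fst_le h.norm_feature_le x t)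
      (norm_singleChain_snd_le hadm.norm_init_snd_le x t) _ _).trans
      (by linarith [hadm.radius_nonneg])
  calc ∫ ω, ‖(𝒵 (X · ω) (t + 1)).2 - θstar‖ ^ 2 ∂ℙ
      ≤ ∫ ω, (‖(𝒵 (X · ω) t).2 - θstar‖ ^ 2 + α * (2 * inner ℝ ((𝒵 (X · ω) t).2 - θstar)
          (gUpdate Φ R (X t ω) (X (t + 1) ω) (𝒵 (X · ω) t).1 (𝒵 (X · ω) t).2))
          + α ^ 2 * (2 * (r + 3 * ϱ)) ^ 2) ∂ℙ := by
        refine integral_mono (integrable_sq _) (by fun_prop) fun ω =>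
          (norm_singleChain_snd_succ_sub_sq_le hθstar (X · ω) t).trans ?_
        gcongr
        exact norm_gUpdate_le_two_mul (X · ω)
    _ = _ := by
        rw [integral_add (by fun_prop) (by fun_prop), integral_add (by fun_prop) (by fun_prop),
          integral_const_mul, integral_const_mul, hX.integral_inner_gUpdate, integral_const,
          probReal_univ, one_smul]
        ring

theorem IsBoundedModel.two_mul_integral_inner_gMean_le (h : IsBoundedModel P μ Φ R r)
    (hX : IsMarkovChain ℙ P X) (hθ₀ : ‖θ₀‖ ≤ ϱ)
    (hroot : gBar P μ Φ R (wStar Φ μ) θstar = 0) {ε : ℝ} (hε : 0 < ε) (t : ℕ) :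
    2 * ∫ ω, inner ℝ ((𝒵 (X · ω) t).2 - θstar)
        (gMean P Φ R (X t ω) (𝒵 (X · ω) t).1 (𝒵 (X · ω) t).2) ∂ℙ
      ≤ -2 * (eta P μ Φ - ε * (r + 2 * ϱ) / 2) * ∫ ω, ‖(𝒵 (X · ω) t).2 - θstar‖ ^ 2 ∂ℙ
        + (r + 2 * ϱ) / ε * ∫ ω, ‖(𝒵 (X · ω) t).1 - wStar Φ μ‖ ^ 2 ∂ℙ
        + 2 * ∫ ω, tdNoise P μ Φ R θstar (X t ω) (𝒵 (X · ω) t).1 (𝒵 (X · ω) t).2 ∂ℙ := by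
  have integrable_inner : Integrable (fun ω => inner ℝ ((𝒵 (X · ω) t).2 - θstar)
      (gMean P Φ R (X t ω) (𝒵 (X · ω) t).1 (𝒵 (X · ω) t).2)) ℙ :=
    hX.integrable_comp_singleChain
      (fun s z => inner ℝ (z.2 - θstar) (gMean P Φ R s z.1 z.2)) t
  have integrable_snd : Integrable (fun ω => ‖(𝒵 (X · ω) t).2 - θstar‖ ^ 2) ℙ :=
    hX.integrable_comp_singleChain (fun _ z => ‖z.2 - θstar‖ ^ 2) t
  have integrable_fst : Integrable (fun ω => ‖(𝒵 (X · ω) t).1 - wStar Φ μ‖ ^ 2) ℙ :=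
    hX.integrable_comp_singleChain (fun _ z => ‖z.1 - wStar Φ μ‖ ^ 2) t
  have integrable_tdNoise : Integrable (fun ω =>
      tdNoise P μ Φ R θstar (X t ω) (𝒵 (X · ω) t).1 (𝒵 (X · ω) t).2) ℙ :=
    hX.integrable_comp_singleChain (fun s z => tdNoise P μ Φ R θstar s z.1 z.2) t
  simp only [← integral_const_mul]
  rw [← integral_add (by fun_prop) (by fun_prop), ← integral_add (by fun_prop) (by fun_prop)]
  exact integral_mono (by fun_prop) (by fun_prop) fun ω =>
    h.two_mul_inner_gMean_le hroot (norm_singleChain_snd_le hθ₀ (X · ω) t) hε (X t ω)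

theorem IsBoundedModel.two_mul_integral_tdNoise_le (h : IsBoundedModel P μ Φ R r)
    (hX : IsMarkovChain ℙ P X) (hadm : IsAdmissible α β Rw ϱ w₀ θ₀) (hθstar : ‖θstar‖ ≤ ϱ)
    {τ : ℕ} (hτ : τ ≠ 0) (hmix : ∀ s, ∑ s', |(P ^ τ) s s' - μ s'| ≤ α) (k : ℕ) :
    2 * ∫ ω, tdNoise P μ Φ R θstar (X (k + τ) ω) (𝒵 (X · ω) (k + τ)).1
        (𝒵 (X · ω) (k + τ)).2 ∂ℙ
      ≤ 88 * τ * α * (r + 3 * ϱ) ^ 2 := by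
  have hr := h.nonneg
  have hα := hadm.alpha_nonneg
  have hϱ := hadm.radius_nonneg
  have hτ' : (1 : ℝ) ≤ τ := Nat.one_le_cast.2 (Nat.one_le_iff_ne_zero.2 hτ)
  have hw (x : ℕ → S) (t : ℕ) := hadm.norm_singleChain_fst_le (R := R) h.norm_feature_le x t
  have hθ (x : ℕ → S) (t : ℕ) : ‖(𝒵 x t).2‖ ≤ ϱ :=
    norm_singleChain_snd_le hadm.norm_init_snd_le x t
  have lag_le : ∫ ω, tdNoise P μ Φ R θstar (X (k + τ) ω) (𝒵 (X · ω) (k + τ)).1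
      (𝒵 (X · ω) (k + τ)).2 ∂ℙ ≤ α * (4 * ϱ * (2 * r + 3 * ϱ))
        + ((4 * r + 18 * ϱ) * (α * (2 * r + 3 * ϱ) * τ) + 4 * ϱ * (r + ϱ) * (2 * α * τ)) := by
    refine hX.integral_lag_le (f := fun s z => tdNoise P μ Φ R θstar s z.1 z.2)
      dependsOn_singleChain (fun z => h.sum_mul_tdNoise z.1 z.2) hmix
      (fun s x => h.abs_tdNoise_le hθstar (hw x k) (hθ x k) s) fun s x => ?_
    rw [← sub_le_iff_le_add']
    refine (h.tdNoise_sub_le hθstar (hw x (k + τ)) (hθ x (k + τ)) (hθ x k) s).trans ?_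
    gcongr
    · exact hadm.norm_singleChain_snd_add_sub_le h.norm_feature_le h.abs_reward_le x k τ
    · exact (hadm.norm_singleChain_fst_add_sub_le h.norm_feature_le x k τ).trans
        (by gcongr; exact hadm.beta_le_alpha)
  calc _ ≤ 2 * (α * (τ * (4 * ϱ * (2 * r + 3 * ϱ)))
        + ((4 * r + 18 * ϱ) * (α * (2 * r + 3 * ϱ) * τ) + 4 * ϱ * (r + ϱ) * (2 * α * τ))) := by
        refine mul_le_mul_of_nonneg_left (lag_le.trans ?_) zero_le_two
        gcongr α * ?_ + _
        exact le_mul_of_one_le_left (by positivity) hτ'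
    _ = α * τ * (16 * r ^ 2 + 128 * (r * ϱ) + 148 * ϱ ^ 2) := by ring
    _ ≤ α * τ * (88 * r ^ 2 + 528 * (r * ϱ) + 792 * ϱ ^ 2) := by gcongr <;> norm_num
    _ = 88 * τ * α * (r + 3 * ϱ) ^ 2 := by ring

end MeanSquare

section SingleState

-- Young's inequality with `y ^ 2 ≤ 4 * Q` overshoots `4 * (Q * G) + 6 * α` by at most `2 * α`, and
-- only if `Q > 3 / 4`. For `1 ≤ 8 * ϱ * ε` the excess is paid by the last term; otherwise the
-- crude bound `2 * e * y ≤ 8 * ϱ` is already good enough.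
theorem two_mul_mul_le_of_sq_le {e y Q G α β ε ϱ : ℝ} (he : 0 ≤ e) (he' : e ≤ 2 * ϱ) (hy : 0 ≤ y)
    (hy' : y ≤ 2) (hyQ : y ^ 2 ≤ 4 * Q) (hQ : Q ≤ 1) (hG : 0 ≤ G) (hβG : 1 - 2 * β ≤ G)
    (hβ : 0 ≤ β) (hβα : β ≤ α) (hε : 0 < ε) :
    2 * e * y ≤ ε * e ^ 2 + (4 * (Q * G) + 6 * α) / ε + 16 * α * ϱ := by
  have hα : 0 ≤ α := hβ.trans hβα
  have hQ' : 0 ≤ Q := by linarith [sq_nonneg y]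
  have hαϱ : 0 ≤ α * ϱ := mul_nonneg hα (by linarith)
  have young {b : ℝ} (hb : y ^ 2 ≤ b) : 2 * e * y ≤ ε * e ^ 2 + b / ε := by
    refine (two_mul_le_add_mul_sq hε).trans ?_
    rw [div_eq_inv_mul]
    gcongr
  have sq_le : y ^ 2 ≤ 4 * (Q * G) + 8 * (β * Q) := by
    linarith [mul_le_mul_of_nonneg_left hβG hQ']
  rcases le_or_gt Q (3 / 4) with hQ_le | hQ_gt
  · have : y ^ 2 ≤ 4 * (Q * G) + 6 * α := by
      linarith [mul_le_mul_of_nonneg_left hQ_le hβ]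
    linarith [young this]
  rcases le_or_gt 1 (8 * ϱ * ε) with hε_large | hε_small
  · have sq_le' : y ^ 2 ≤ 4 * (Q * G) + 6 * α + 2 * α := by
      linarith [mul_le_mul_of_nonneg_left hQ hβ]
    have excess_le : 2 * α / ε ≤ 16 * α * ϱ := by
      rw [div_le_iff₀ hε]
      linarith [mul_le_mul_of_nonneg_left hε_large hα]
    linarith [young sq_le', add_div (4 * (Q * G) + 6 * α) (2 * α) ε]
  · have one_le : 1 ≤ 4 * (Q * G) + 6 * α := by
      linarith [mul_le_mul_of_nonneg_right hQ_gt.le hG]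
    have crude_le : 2 * e * y ≤ 8 * ϱ := by
      linarith [mul_le_mul he' hy' hy (he.trans he')]
    have : 8 * ϱ ≤ (4 * (Q * G) + 6 * α) / ε := (le_div_iff₀ hε).2 (by linarith)
    linarith [mul_nonneg hε.le (sq_nonneg e)]

theorem one_sub_sq_le_exp {β : ℝ} (hβ : β ≤ 1) : (1 - β) ^ 2 ≤ Real.exp (-2 * β) :=
  calc (1 - β) ^ 2 ≤ Real.exp (-β) ^ 2 :=
        pow_le_pow_left₀ (sub_nonneg.2 hβ) (Real.one_sub_le_exp_neg β) 2
    _ = Real.exp (-2 * β) := by rw [← Real.exp_nat_mul]; congr 1; push_cast; ring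

theorem one_sub_two_mul_le_exp (β : ℝ) : 1 - 2 * β ≤ Real.exp (-2 * β) :=
  (Real.one_sub_le_exp_neg (2 * β)).trans_eq (by rw [neg_mul])

variable {S : Type*} {d : ℕ} {Φ : Matrix S (Fin d) ℝ} {R : S → ℝ} {μ : S → ℝ} {α β Rw ϱ r : ℝ}
  {w₀ θ₀ θstar w θ : EuclideanSpace ℝ (Fin d)}

theorem norm_gUpdate_self_le (hΦ : ∀ s, ‖feature Φ s‖ ≤ 1) (hR : ∀ s, |R s| ≤ r) (hw : ‖w‖ ≤ 1)
    (hθ : ‖θ‖ ≤ ϱ) (s : S) : ‖gUpdate Φ R s s w θ‖ ≤ 2 * r + ϱ := by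
  have gUpdate_eq : gUpdate Φ R s s w θ
      = R s • (feature Φ s - w) - inner ℝ (feature Φ s) θ • w := by
    rw [gUpdate]
    module
  calc ‖gUpdate Φ R s s w θ‖
      ≤ |R s| * ‖feature Φ s - w‖ + |inner ℝ (feature Φ s) θ| * ‖w‖ := by
        rw [gUpdate_eq]
        exact (norm_sub_le _ _).trans_eq (by simp only [norm_smul, Real.norm_eq_abs])
    _ ≤ r * 2 + ϱ * 1 := by
        gcongr
        · exact (abs_nonneg _).trans (hR s)
        · exact hR s
        · exact (norm_sub_le_two_mul (hΦ s) hw).trans_eq (mul_one 2)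
        · exact (norm_nonneg θ).trans hθ
        · exact abs_inner_feature_le hΦ hθ s
    _ = 2 * r + ϱ := by ring

local notation "𝒵" => singleChain Φ R α β Rw ϱ w₀ θ₀

variable [Fintype S] [Subsingleton S]

theorem wStar_eq_feature (hμ : ∑ s, μ s = 1) (s : S) : wStar Φ μ = feature Φ s := by
  rw [Fintype.sum_subsingleton _ s] at hμ
  rw [wStar_eq_sum, Fintype.sum_subsingleton _ s, hμ, one_smul]

variable [DecidableEq S] {P : Matrix S S ℝ}

theorem IsBoundedModel.gUpdate_eq_gBar (h : IsBoundedModel P μ Φ R r) (s s' : S)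
    (w θ : EuclideanSpace ℝ (Fin d)) : gUpdate Φ R s s' w θ = gBar P μ Φ R w θ := by
  have hμ := h.stationary.sum_one
  have hP := sum_row_of_mem_rowStochastic h.stochastic s
  rw [Fintype.sum_subsingleton _ s] at hμ hP
  rw [gBar_eq_sum h.stochastic, Fintype.sum_subsingleton _ s, hμ, one_smul, gMean,
    Fintype.sum_subsingleton _ s, hP, one_smul, Subsingleton.elim s' s]

theorem IsBoundedModel.norm_singleChain_fst_sub_wStar_sq_le_of_subsingleton
    (h : IsBoundedModel P μ Φ R r) (hadm : IsAdmissible α β Rw ϱ w₀ θ₀) (x : ℕ → S) (t : ℕ) :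
    ‖(𝒵 x t).1 - wStar Φ μ‖ ^ 2 ≤ 4 * Real.exp (-2 * β) ^ t := by
  have feature_eq (s : S) : feature Φ s = wStar Φ μ :=
    (wStar_eq_feature h.stationary.sum_one s).symm
  have init_le : ‖w₀ - wStar Φ μ‖ ≤ 2 * 1 :=
    norm_sub_le_two_mul hadm.norm_init_fst_le h.norm_wStar_le
  calc ‖(𝒵 x t).1 - wStar Φ μ‖ ^ 2 = ((1 - β) ^ 2) ^ t * ‖w₀ - wStar Φ μ‖ ^ 2 := by
        rw [hadm.singleChain_fst h.norm_feature_le, movingAverage_sub_of_const feature_eq,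
          norm_smul, mul_pow, norm_pow, Real.norm_eq_abs, pow_right_comm, sq_abs]
    _ ≤ Real.exp (-2 * β) ^ t * (2 * 1) ^ 2 := by
        gcongr
        exact one_sub_sq_le_exp hadm.beta_le_one
    _ = 4 * Real.exp (-2 * β) ^ t := by ring

theorem IsBoundedModel.norm_singleChain_snd_succ_sub_sq_le_of_subsingleton
    (h : IsBoundedModel P μ Φ R r) (hadm : IsAdmissible α β Rw ϱ w₀ θ₀) (hθstar : ‖θstar‖ ≤ ϱ)
    (hroot : gBar P μ Φ R (wStar Φ μ) θstar = 0) {ε : ℝ} (hε : 0 < ε) (x : ℕ → S) (t : ℕ) :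
    ‖(𝒵 x (t + 1)).2 - θstar‖ ^ 2
      ≤ (1 - 2 * α * (eta P μ Φ - ε * (r + 2 * ϱ) / 2)) * ‖(𝒵 x t).2 - θstar‖ ^ 2
        + α * (r + 2 * ϱ) / ε * (4 * Real.exp (-2 * β) ^ (t + 1) + 6 * α)
        + 4 * α ^ 2 * (r + 3 * ϱ) ^ 2 := by
  have hr := h.nonneg
  have hα := hadm.alpha_nonneg
  have hϱ := hadm.radius_nonneg
  set w := (𝒵 x t).1
  set θ := (𝒵 x t).2
  have hw : ‖w‖ ≤ 1 := hadm.norm_singleChain_fst_le h.norm_feature_le x t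
  have hθ : ‖θ‖ ≤ ϱ := norm_singleChain_snd_le hadm.norm_init_snd_le x t
  have exp_le_one : Real.exp (-2 * β) ≤ 1 := Real.exp_le_one_iff.2 (by linarith [hadm.beta_nonneg])
  have young : 2 * ‖θ - θstar‖ * ‖w - wStar Φ μ‖ ≤ ε * ‖θ - θstar‖ ^ 2
      + (4 * (Real.exp (-2 * β) ^ t * Real.exp (-2 * β)) + 6 * α) / ε + 16 * α * ϱ :=
    two_mul_mul_le_of_sq_le (norm_nonneg _) (norm_sub_le_two_mul hθ hθstar) (norm_nonneg _)
      ((norm_sub_le_two_mul hw h.norm_wStar_le).trans_eq (mul_one 2))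
      (h.norm_singleChain_fst_sub_wStar_sq_le_of_subsingleton hadm x t)
      (pow_le_one₀ (Real.exp_nonneg _) exp_le_one) (Real.exp_nonneg _) (one_sub_two_mul_le_exp β)
      hadm.beta_nonneg hadm.beta_le_alpha hε
  have norm_gBar_le : ‖gBar P μ Φ R w θ‖ ≤ 2 * r + ϱ := by
    rw [← h.gUpdate_eq_gBar (x t) (x t)]
    exact norm_gUpdate_self_le h.norm_feature_le h.abs_reward_le hw hθ (x t)
  calc ‖(𝒵 x (t + 1)).2 - θstar‖ ^ 2
      ≤ ‖θ - θstar‖ ^ 2 + α * (2 * inner ℝ (θ - θstar) (gBar P μ Φ R w θ))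
        + α ^ 2 * ‖gBar P μ Φ R w θ‖ ^ 2 := by
        rw [← h.gUpdate_eq_gBar (x t) (x (t + 1))]
        exact norm_singleChain_snd_succ_sub_sq_le hθstar x t
    _ ≤ ‖θ - θstar‖ ^ 2 + α * (-2 * eta P μ Φ * ‖θ - θstar‖ ^ 2
          + (r + 2 * ϱ) * (ε * ‖θ - θstar‖ ^ 2
            + (4 * (Real.exp (-2 * β) ^ t * Real.exp (-2 * β)) + 6 * α) / ε + 16 * α * ϱ))
        + α ^ 2 * (2 * r + ϱ) ^ 2 := by
        gcongr
        exact (h.two_mul_inner_gBar_le hroot hθ).trans (by gcongr)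
    _ = (1 - 2 * α * (eta P μ Φ - ε * (r + 2 * ϱ) / 2)) * ‖θ - θstar‖ ^ 2
        + α * (r + 2 * ϱ) / ε * (4 * Real.exp (-2 * β) ^ (t + 1) + 6 * α)
        + (4 * α ^ 2 * (r + 3 * ϱ) ^ 2 - α ^ 2 * (4 * r * ϱ + 3 * ϱ ^ 2)) := by ring
    _ ≤ _ := by
        gcongr
        exact sub_le_self _ (by positivity)

end SingleState

section FiniteTimeBound

variable {S Ω : Type*} [MeasurableSpace Ω] {ℙ : Measure Ω} [IsProbabilityMeasure ℙ]
  {d : ℕ} {Φ : Matrix S (Fin d) ℝ} {R : S → ℝ} {P : Matrix S S ℝ} {X : ℕ → Ω → S}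
  {α β Rw ϱ r ε ζ : ℝ} {μ : S → ℝ} {w₀ θ₀ θstar : EuclideanSpace ℝ (Fin d)} {τ : ℕ}

local notation "𝒵" => singleChain Φ R α β Rw ϱ w₀ θ₀

theorem IsMarkovChain.integral_norm_singleChain_snd_sub_sq_le_four_mul [Finite S]
    (hX : IsMarkovChain ℙ P X) (hθ₀ : ‖θ₀‖ ≤ ϱ) (hθstar : ‖θstar‖ ≤ ϱ) (t : ℕ) :
    ∫ ω, ‖(𝒵 (X · ω) t).2 - θstar‖ ^ 2 ∂ℙ ≤ 4 * ϱ ^ 2 :=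
  calc ∫ ω, ‖(𝒵 (X · ω) t).2 - θstar‖ ^ 2 ∂ℙ ≤ ∫ _, (2 * ϱ) ^ 2 ∂ℙ := by
        refine integral_mono (hX.integrable_comp_singleChain (fun _ z => ‖z.2 - θstar‖ ^ 2) t)
          (integrable_const _) fun ω => ?_
        exact pow_le_pow_left₀ (norm_nonneg _)
          (norm_sub_le_two_mul (norm_singleChain_snd_le hθ₀ (X · ω) t) hθstar) 2
    _ = 4 * ϱ ^ 2 := by
        rw [integral_const, probReal_univ, one_smul]
        ring

variable [Fintype S] [DecidableEq S]

theorem IsBoundedModel.integral_norm_singleChain_fst_sub_wStar_sq_le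
    (h : IsBoundedModel P μ Φ R r) (hX : IsMarkovChain ℙ P X)
    (hadm : IsAdmissible α β Rw ϱ w₀ θ₀) (hτ : τ ≠ 0)
    (hmix : ∀ s, ∑ s', |(P ^ τ) s s' - μ s'| ≤ β) (k : ℕ) :
    ∫ ω, ‖(𝒵 (X · ω) (k + τ)).1 - wStar Φ μ‖ ^ 2 ∂ℙ
      ≤ 4 * Real.exp (-2 * β) ^ (k + 1) + (16 * τ + 6) * α := by
  have hβ := hadm.beta_nonneg
  set G := Real.exp (-2 * β)
  have hτ' : (1 : ℝ) ≤ τ := Nat.one_le_cast.2 (Nat.one_le_iff_ne_zero.2 hτ)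
  have pow_le_pow_succ_add : G ^ k ≤ G ^ (k + 1) + 2 * β := by
    have hGk : G ^ k ≤ 1 :=
      pow_le_one₀ (Real.exp_nonneg _) (Real.exp_le_one_iff.2 (by linarith))
    calc G ^ k = G ^ k * (1 - 2 * β) + 2 * β * G ^ k := by ring
      _ ≤ G ^ k * G + 2 * β * 1 := by
        gcongr
        exact one_sub_two_mul_le_exp β
      _ = G ^ (k + 1) + 2 * β := by ring
  simp only [hadm.singleChain_fst h.norm_feature_le, wStar_eq_sum]
  calc _ ≤ 4 * ((1 - β) ^ 2) ^ k + β * (4 * τ + 6) :=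
        hX.integral_norm_movingAverage_sub_sq_le h.stationary hβ hadm.beta_le_one
          h.norm_feature_le hadm.norm_init_fst_le hmix k
    _ ≤ 4 * (G ^ (k + 1) + 2 * β) + β * (4 * τ + 6) := by
        gcongr
        exact (pow_le_pow_left₀ (sq_nonneg _) (one_sub_sq_le_exp hadm.beta_le_one) k).trans
          pow_le_pow_succ_add
    _ = 4 * G ^ (k + 1) + (4 * τ + 14) * β := by ring
    _ ≤ 4 * G ^ (k + 1) + (16 * τ + 6) * α := by
        gcongr _ + ?_ * ?_
        · linarith
        · exact hadm.beta_le_alpha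

theorem IsBoundedModel.integral_norm_singleChain_snd_succ_sub_sq_le_of_ne_zero
    (h : IsBoundedModel P μ Φ R r) (hX : IsMarkovChain ℙ P X)
    (hadm : IsAdmissible α β Rw ϱ w₀ θ₀) (hθstar : ‖θstar‖ ≤ ϱ)
    (hroot : gBar P μ Φ R (wStar Φ μ) θstar = 0) (hε : 0 < ε) (hτ : τ ≠ 0)
    (hmix : ∀ s, ∑ s', |(P ^ τ) s s' - μ s'| ≤ min α β) (k : ℕ) :
    ∫ ω, ‖(𝒵 (X · ω) (k + τ + 1)).2 - θstar‖ ^ 2 ∂ℙ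
      ≤ (1 - 2 * α * (eta P μ Φ - ε * (r + 2 * ϱ) / 2))
          * ∫ ω, ‖(𝒵 (X · ω) (k + τ)).2 - θstar‖ ^ 2 ∂ℙ
        + α * (r + 2 * ϱ) / ε * (4 * Real.exp (-2 * β) ^ (k + 1) + (16 * τ + 6) * α)
        + (88 * τ + 4) * α ^ 2 * (r + 3 * ϱ) ^ 2 := by
  have hr := h.nonneg
  have hα := hadm.alpha_nonneg
  have hϱ := hadm.radius_nonneg
  have hmixα (s : S) : ∑ s', |(P ^ τ) s s' - μ s'| ≤ α := (hmix s).trans (min_le_left _ _)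
  have hmixβ (s : S) : ∑ s', |(P ^ τ) s s' - μ s'| ≤ β := (hmix s).trans (min_le_right _ _)
  set E := ∫ ω, ‖(𝒵 (X · ω) (k + τ)).2 - θstar‖ ^ 2 ∂ℙ
  calc ∫ ω, ‖(𝒵 (X · ω) (k + τ + 1)).2 - θstar‖ ^ 2 ∂ℙ
      ≤ E + α * (2 * ∫ ω, inner ℝ ((𝒵 (X · ω) (k + τ)).2 - θstar)
          (gMean P Φ R (X (k + τ) ω) (𝒵 (X · ω) (k + τ)).1 (𝒵 (X · ω) (k + τ)).2) ∂ℙ)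
        + 4 * α ^ 2 * (r + 3 * ϱ) ^ 2 :=
        h.integral_norm_singleChain_snd_succ_sub_sq_le_gMean hX hadm hθstar (k + τ)
    _ ≤ E + α * (-2 * (eta P μ Φ - ε * (r + 2 * ϱ) / 2) * E
          + (r + 2 * ϱ) / ε * (4 * Real.exp (-2 * β) ^ (k + 1) + (16 * τ + 6) * α)
          + 88 * τ * α * (r + 3 * ϱ) ^ 2)
        + 4 * α ^ 2 * (r + 3 * ϱ) ^ 2 := by
        gcongr
        refine (h.two_mul_integral_inner_gMean_le hX hadm.norm_init_snd_le hroot hε _).trans ?_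
        gcongr _ + _ * ?_ + ?_
        · exact h.integral_norm_singleChain_fst_sub_wStar_sq_le hX hadm hτ hmixβ k
        · exact h.two_mul_integral_tdNoise_le hX hadm hθstar hτ hmixα k
    _ = _ := by ring

theorem IsBoundedModel.integral_norm_singleChain_snd_succ_sub_sq_le
    (h : IsBoundedModel P μ Φ R r) (hX : IsMarkovChain ℙ P X)
    (hadm : IsAdmissible α β Rw ϱ w₀ θ₀) (hα : α < 1) (hθstar : ‖θstar‖ ≤ ϱ)
    (hroot : gBar P μ Φ R (wStar Φ μ) θstar = 0) (hε : 0 < ε)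
    (hmix : ∀ s, ∑ s', |(P ^ τ) s s' - μ s'| ≤ min α β) (k : ℕ) :
    ∫ ω, ‖(𝒵 (X · ω) (k + τ + 1)).2 - θstar‖ ^ 2 ∂ℙ
      ≤ (1 - 2 * α * (eta P μ Φ - ε * (r + 2 * ϱ) / 2))
          * ∫ ω, ‖(𝒵 (X · ω) (k + τ)).2 - θstar‖ ^ 2 ∂ℙ
        + α * (r + 2 * ϱ) / ε * (4 * Real.exp (-2 * β) ^ (k + 1) + (16 * τ + 6) * α)
        + (88 * τ + 4) * α ^ 2 * (r + 3 * ϱ) ^ 2 := by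
  rcases eq_or_ne τ 0 with rfl | hτ
  · have : Subsingleton S := subsingleton_of_sum_abs_one_sub_lt fun s => by
      rw [← pow_zero P]
      exact (hmix s).trans_lt ((min_le_left _ _).trans_lt hα)
    have integrable_sq (t : ℕ) : Integrable (fun ω => ‖(𝒵 (X · ω) t).2 - θstar‖ ^ 2) ℙ :=
      hX.integrable_comp_singleChain (fun _ z => ‖z.2 - θstar‖ ^ 2) t
    refine (integral_mono (integrable_sq _) (by fun_prop) fun ω =>
      h.norm_singleChain_snd_succ_sub_sq_le_of_subsingleton hadm hθstar hroot hε
        (X · ω) k).trans_eq ?_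
    rw [integral_add (by fun_prop) (by fun_prop), integral_add (by fun_prop) (by fun_prop),
      integral_const_mul, integral_const, integral_const, probReal_univ, one_smul, one_smul,
      Nat.cast_zero, mul_zero, mul_zero, zero_add, zero_add, add_zero]
  · exact h.integral_norm_singleChain_snd_succ_sub_sq_le_of_ne_zero hX hadm hθstar hroot hε hτ
      hmix k

theorem IsBoundedModel.integral_norm_singleChain_snd_sub_sq_le
    (h : IsBoundedModel P μ Φ R r) (hX : IsMarkovChain ℙ P X)
    (hadm : IsAdmissible α β Rw ϱ w₀ θ₀) (hα : α < 1) (hθstar : ‖θstar‖ ≤ ϱ)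
    (hroot : gBar P μ Φ R (wStar Φ μ) θstar = 0) (hε : 0 < ε)
    (hmix : ∀ s, ∑ s', |(P ^ τ) s s' - μ s'| ≤ min α β)
    (hζ : ζ = eta P μ Φ - ε * (r + 2 * ϱ) / 2) (hζ_pos : 0 < ζ) (hκ : 0 ≤ 1 - 2 * α * ζ)
    (n : ℕ) :
    ∫ ω, ‖(𝒵 (X · ω) (n + τ)).2 - θstar‖ ^ 2 ∂ℙ
      ≤ n * (4 * α * (r + 2 * ϱ) / ε) * (max (1 - 2 * α * ζ) (Real.exp (-2 * β))) ^ n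
        + 4 * ϱ ^ 2 * (1 - 2 * α * ζ) ^ n
        + α * ((16 * τ + 6) * (r + 2 * ϱ) / ε + (88 * τ + 4) * (r + 3 * ϱ) ^ 2) / (2 * ζ) := by
  have hr := h.nonneg
  have hα' := hadm.alpha_nonneg
  have hϱ := hadm.radius_nonneg
  set C := (16 * τ + 6) * (r + 2 * ϱ) / ε + (88 * τ + 4) * (r + 3 * ϱ) ^ 2 with hC
  have fixed_point : (1 - 2 * α * ζ) * (α * C / (2 * ζ)) + α ^ 2 * C = α * C / (2 * ζ) := by
    field_simp
    ring
  refine le_of_linear_recurrence (u := fun n => ∫ ω, ‖(𝒵 (X · ω) (n + τ)).2 - θstar‖ ^ 2 ∂ℙ)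
    hκ (le_max_left _ _) (by positivity) fixed_point.le ?_ (fun n => ?_) n
  · exact le_add_of_le_of_nonneg
      (hX.integral_norm_singleChain_snd_sub_sq_le_four_mul hadm.norm_init_snd_le hθstar _)
      (by positivity)
  · calc _ ≤ (1 - 2 * α * ζ) * ∫ ω, ‖(𝒵 (X · ω) (n + τ)).2 - θstar‖ ^ 2 ∂ℙ
          + 4 * α * (r + 2 * ϱ) / ε * Real.exp (-2 * β) ^ (n + 1) + α ^ 2 * C := by
          rw [add_right_comm, hζ]
          refine (h.integral_norm_singleChain_snd_succ_sub_sq_le hX hadm hα hθstar hroot hε hmix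
            n).trans_eq ?_
          rw [hC]
          ring
      _ ≤ _ := by
          gcongr
          exact le_max_right _ _

theorem IsBoundedModel.integral_norm_singleChain_snd_sub_sq_le_of_one_le
    (h : IsBoundedModel P μ Φ R r) (hX : IsMarkovChain ℙ P X) (hα : 1 ≤ α) (hθ₀ : ‖θ₀‖ ≤ ϱ)
    (hθstar : ‖θstar‖ ≤ ϱ) (hε : 0 < ε) (hζ_pos : 0 < ζ) (hκ : 0 ≤ 1 - 2 * α * ζ) (t τ : ℕ) :
    ∫ ω, ‖(𝒵 (X · ω) t).2 - θstar‖ ^ 2 ∂ℙ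
      ≤ α * ((16 * τ + 6) * (r + 2 * ϱ) / ε + (88 * τ + 4) * (r + 3 * ϱ) ^ 2) / (2 * ζ) := by
  have hr := h.nonneg
  have hϱ : 0 ≤ ϱ := (norm_nonneg _).trans hθ₀
  have two_mul_le_alpha : 2 * ζ ≤ α := by
    linarith [mul_le_mul_of_nonneg_right hα hζ_pos.le]
  have hC : 4 * ϱ ^ 2
      ≤ (16 * τ + 6) * (r + 2 * ϱ) / ε + (88 * τ + 4) * (r + 3 * ϱ) ^ 2 := by
    rw [← zero_add (4 * ϱ ^ 2)]
    gcongr ?_ + ?_ * ?_ ^ 2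
    · positivity
    · exact le_add_of_nonneg_left (by positivity)
    · linarith
  refine (hX.integral_norm_singleChain_snd_sub_sq_le_four_mul hθ₀ hθstar t).trans (hC.trans ?_)
  rw [le_div_iff₀ (by positivity), mul_comm]
  gcongr

end FiniteTimeBound

end AvgRewardTD

theorem theorem4_general {S Ω : Type*} [Fintype S] [DecidableEq S] [MeasurableSpace Ω]
    (ℙ : Measure Ω) [IsProbabilityMeasure ℙ] {d : ℕ} (P : Matrix S S ℝ) (R : S → ℝ) (r : ℝ)
    (μ : S → ℝ) (Φ : Matrix S (Fin d) ℝ) (h : AvgRewardTD.IsBoundedModel P μ Φ R r)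
    (X : ℕ → Ω → S) (hX : AvgRewardTD.IsMarkovChain ℙ P X)
    (Rw Rθ : ℝ) (hRw : 1 ≤ Rw) (hRθ : 0 < Rθ)
    (w₀ θ₀ θstar : EuclideanSpace ℝ (Fin d)) (hw₀ : ‖w₀‖ ≤ 1) (hθ₀ : ‖θ₀‖ ≤ Rθ)
    (hθstar : AvgRewardTD.gBar P μ Φ R (AvgRewardTD.wStar Φ μ) θstar = 0)
    (hθstar_le : ‖θstar‖ ≤ Rθ)
    (α β ρ₀ : ℝ) (hα : 0 < α) (hβ : 0 < β) (hρ₀ : ρ₀ = β / α) (hρ₀_le : ρ₀ ≤ 1)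
    (τ : ℕ) (hτ : ∀ s, ∑ s', |(P ^ τ) s s' - μ s'| ≤ min α β)
    (η lam ζ : ℝ) (hη : η = AvgRewardTD.eta P μ Φ)
    (hlam : 0 < lam) (hlam_lt : lam ^ 2 < 2 * η / (r + 2 * Rθ))
    (hζ : ζ = η - lam ^ 2 * (r + 2 * Rθ) / 2) (hα_lt : α < 1 / (2 * ζ))
    (κ G₁ ρ Gconst : ℝ) (hκ : κ = 1 - 2 * α * ζ)
    (hG₁ : G₁ = Real.exp (-2 * ρ₀ * α)) (hρ : ρ = max κ G₁)
    (hGconst : Gconst = (16 * τ + 6) * (r + 2 * Rθ) / lam ^ 2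
      + (88 * τ + 4) * (r + 3 * Rθ) ^ 2) :
    0 < ζ ∧ κ ∈ Set.Ioo 0 1 ∧ G₁ ∈ Set.Ioo 0 1 ∧ ρ ∈ Set.Ioo 0 1 ∧
    ∀ t : ℕ, τ ≤ t →
      Integrable (fun ω => ‖(AvgRewardTD.singleChain Φ R α β Rw Rθ w₀ θ₀
        (fun i => X i ω) t).2 - θstar‖ ^ 2) ℙ ∧
      ∫ ω, ‖(AvgRewardTD.singleChain Φ R α β Rw Rθ w₀ θ₀
          (fun i => X i ω) t).2 - θstar‖ ^ 2 ∂ℙ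
        ≤ 4 * α * (r + 2 * Rθ) * ((t : ℝ) - τ) * ρ ^ (t - τ) / lam ^ 2
          + 4 * Rθ ^ 2 * κ ^ (t - τ)
          + α * Gconst / (2 * ζ) := by
  have hr := h.nonneg
  have hlam_sq : 0 < lam ^ 2 := pow_pos hlam 2
  have hβα : β ≤ α := by rwa [hρ₀, div_le_one hα] at hρ₀_le
  have hG₁_eq : G₁ = Real.exp (-2 * β) := by
    rw [hG₁, hρ₀, mul_assoc, div_mul_cancel₀ _ hα.ne']
  have hζ_pos : 0 < ζ := by
    rw [lt_div_iff₀ (by positivity)] at hlam_lt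
    linarith
  have hκ_mem : κ ∈ Set.Ioo 0 1 := by
    rw [lt_div_iff₀ (by positivity)] at hα_lt
    exact ⟨by linarith, by linarith [mul_pos hα hζ_pos]⟩
  have hG₁_mem : G₁ ∈ Set.Ioo 0 1 := hG₁_eq ▸ ⟨Real.exp_pos _, Real.exp_lt_one_iff.2 (by linarith)⟩
  have hρ_mem : ρ ∈ Set.Ioo 0 1 := hρ ▸ max_rec' (· ∈ Set.Ioo 0 1) hκ_mem hG₁_mem
  refine ⟨hζ_pos, hκ_mem, hG₁_mem, hρ_mem, fun t ht =>
    ⟨hX.integrable_comp_singleChain (fun _ z => ‖z.2 - θstar‖ ^ 2) t, ?_⟩⟩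
  obtain ⟨n, rfl⟩ := Nat.exists_eq_add_of_le' ht
  rw [Nat.add_sub_cancel, Nat.cast_add, add_sub_cancel_right, hGconst]
  rcases lt_or_ge α 1 with hα_lt_one | hα_ge_one
  · have hadm : AvgRewardTD.IsAdmissible α β Rw Rθ w₀ θ₀ :=
      ⟨hβ.le, hβα.trans hα_lt_one.le, hβα, hRw, hw₀, hθ₀⟩
    refine (h.integral_norm_singleChain_snd_sub_sq_le hX hadm hα_lt_one hθstar_le hθstar hlam_sq
      hτ (hη ▸ hζ) hζ_pos (hκ ▸ hκ_mem.1.le) n).trans_eq ?_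
    rw [← hκ, ← hG₁_eq, ← hρ]
    ring
  · refine (h.integral_norm_singleChain_snd_sub_sq_le_of_one_le hX hα_ge_one hθ₀ hθstar_le hlam_sq
      hζ_pos (hκ ▸ hκ_mem.1.le) (n + τ) τ).trans (le_add_of_nonneg_left ?_)
    have := hκ_mem.1.le
    have := hρ_mem.1.le
    positivity

theorem theorem4 {S A Ω : Type*} [Fintype S] [DecidableEq S] [Fintype A]
    [MeasurableSpace Ω] (ℙ : Measure Ω) [IsProbabilityMeasure ℙ] {d : ℕ}
    (M : AvgRewardTD.FiniteMDP S A) (pol : AvgRewardTD.Policy S A)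
    (P : Matrix S S ℝ) (hP : P = M.transMatrix pol)
    (hirr : P.IsIrreducible) (haper : AvgRewardTD.IsAperiodic P)
    (R : S → ℝ) (hR : R = M.rewardVec pol)
    (rmax : ℝ) (hrmax : rmax = M.rMax)
    (μ : S → ℝ) (hμ : AvgRewardTD.IsStationary P μ)
    (Φ : Matrix S (Fin d) ℝ)
    (hΦnorm : ∀ s, ‖AvgRewardTD.feature Φ s‖ ≤ 1)
    (hΦind : LinearIndependent ℝ Φ.col)
    (X : ℕ → Ω → S) (hX : AvgRewardTD.IsMarkovChain ℙ P X)
    (Rw Rθ : ℝ) (hRw : 1 ≤ Rw) (hRθ : 0 < Rθ)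
    (w₀ θ₀ θstar : EuclideanSpace ℝ (Fin d)) (hw₀ : ‖w₀‖ ≤ 1) (hθ₀ : ‖θ₀‖ ≤ Rθ)
    (hθstar : AvgRewardTD.gBar P μ Φ R (AvgRewardTD.wStar Φ μ) θstar = 0)
    (hθstar_le : ‖θstar‖ ≤ Rθ)
    (α β ρ₀ : ℝ) (hα : 0 < α) (hβ : 0 < β) (hρ₀ : ρ₀ = β / α) (hρ₀_le : ρ₀ ≤ 1)
    (τ : ℕ) (hτ : τ = AvgRewardTD.mixingTime P μ (min α β))
    (η lam ζ : ℝ) (hη : η = AvgRewardTD.eta P μ Φ)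
    (hlam : 0 < lam) (hlam_lt : lam ^ 2 < 2 * η / (rmax + 2 * Rθ))
    (hζ : ζ = η - lam ^ 2 * (rmax + 2 * Rθ) / 2) (hα_lt : α < 1 / (2 * ζ))
    (κ G₁ ρ Gconst : ℝ) (hκ : κ = 1 - 2 * α * ζ)
    (hG₁ : G₁ = Real.exp (-2 * ρ₀ * α)) (hρ : ρ = max κ G₁)
    (hGconst : Gconst = (16 * τ + 6) * (rmax + 2 * Rθ) / lam ^ 2
      + (88 * τ + 4) * (rmax + 3 * Rθ) ^ 2) :
    0 < ζ ∧ κ ∈ Set.Ioo 0 1 ∧ G₁ ∈ Set.Ioo 0 1 ∧ ρ ∈ Set.Ioo 0 1 ∧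
    ∀ t : ℕ, τ ≤ t →
      Integrable (fun ω => ‖(AvgRewardTD.singleChain Φ R α β Rw Rθ w₀ θ₀
        (fun i => X i ω) t).2 - θstar‖ ^ 2) ℙ ∧
      ∫ ω, ‖(AvgRewardTD.singleChain Φ R α β Rw Rθ w₀ θ₀
          (fun i => X i ω) t).2 - θstar‖ ^ 2 ∂ℙ
        ≤ 4 * α * (rmax + 2 * Rθ) * ((t : ℝ) - τ) * ρ ^ (t - τ) / lam ^ 2
          + 4 * Rθ ^ 2 * κ ^ (t - τ)
          + α * Gconst / (2 * ζ) := by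
  subst hP hR hrmax
  exact theorem4_general ℙ _ _ _ μ Φ
    ⟨M.transMatrix_mem_rowStochastic pol, hμ, hΦnorm, M.abs_rewardVec_le pol⟩ X hX Rw Rθ hRw hRθ
    w₀ θ₀ θstar hw₀ hθ₀ hθstar hθstar_le α β ρ₀ hα hβ hρ₀ hρ₀_le τ
    (hτ ▸ hμ.sum_abs_pow_mixingTime_sub_le (haper.isPrimitive hirr)
      (M.transMatrix_mem_rowStochastic pol) (lt_min hα hβ))
    η lam ζ hη hlam hlam_lt hζ hα_lt κ G₁ ρ Gconst hκ hG₁ hρ hGconst
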